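/- \textbf{Classes of groups.} Let $\Gamma$ be a group and $\mathcal{G}$ a family of groups $G$ with bounded bi-invariant metrics $d$. $\Gamma$ is \emph{$\mathcal{G}$-approximable} if there is $c>0$ such that for every finite $F\subseteq\Gamma$ and $\varepsilon>0$ there are $(G,d)\in\mathcal{G}$ and a map $\varphi:\Gamma\to G$ with $\varphi(e)=e$, with $d(\varphi(gh),\varphi(g)\varphi(h))<\varepsilon$ whenever $g,h,gh\in F$ (\emph{$(F,\varepsilon)$-multiplicativity}), and with $d(\varphi(g),e)>c$ for all $e\ne g\in F$. $\Gamma$ is \emph{sofic}, \emph{$\mathbb{K}$-linear sofic} (for a field $\mathbb{K}$), \emph{hyperlinear} or \emph{weakly sofic} if it is approximable with respect to, respectively, the groups $\mathrm{Sym}(n)$ with the normalized Hamming metric; the groups $\mathrm{GL}_n(\mathbb{K})$ with the metric $\frac1n\mathrm{rk}(M-N)$; the unitary groups $U(n)$ with the normalized Hilbert--Schmidt metric $\big(\frac1n\sum_{i,j}|A_{ij}-B_{ij}|^2\big)^{1/2}$ ($n\ge 1$ in these three cases); all finite groups with bi-invariant metrics of diameter one. \textbf{Sofic actions.} An action of $\Gamma$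 on a set $X$ is \emph{sofic} if for all finite $F\subseteq\Gamma$, $E\subseteq X$ and all $\varepsilon>0$ there are a finite set $A$ and a map $\varphi:\Gamma\to\mathrm{Sym}(A)$ with $\varphi(e)=\mathrm{id}$ which is $(F,\varepsilon)$-multiplicative for the normalized Hamming metric, a finite set $B$, a subset $S\subseteq A$ with $|S|>(1-\varepsilon)|A|$, and injections $\pi_s:E\to B$ ($s\in S$) such that $\pi_{\varphi(g)s}(x)=\pi_s(g^{-1}x)$ whenever $g\in F$, $x\in E$, $s\in S$, $\varphi(g)s\in S$ and $g^{-1}x\in E$. For an action by automorphisms on a (simple) graph $X$, $E$ is instead a finite induced subgraph of $X$, $B$ is a finite graph and the $\pi_s$ are isomorphisms onto induced subgraphs of $B$. \textbf{Haloes.} A \emph{halo of groups} over a set $X$ is a family of groups $L(Y)$, $Y\subseteq X$, with $L(Z)\le L(Y)$ for $Z\subseteq Y$, $L(\emptyset)=1$, $L(X)=\langle L(Y): Y\subseteq X\text{ finite}\rangle$ and $L(Y\cap Z)=L(Y)\cap L(Z)$. A \emph{set-theoretic} (respectively \emph{graph-theoretic}) halo is a functor $\mathcal{L}: X\mapsto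 L(X)$ from sets and injections (respectively graphs and embeddings as induced subgraphs) to groups and monomorphisms such that, for every set (graph) $X$, the images in $L(X)$ of the groups $L(Y)$, for $Y$ a subset (induced subgraph) of $X$, form a halo of groups over (the vertex set of) $X$; these images are again denoted $L(Y)$. We say that $\mathcal{L}$ satisfies (a) and (b) if for every set (graph) $X$: (a) $L(Y\cup Z)=\langle L(Y)\cup L(Z)\rangle$ for all $Y,Z\subseteq X$; (b) for every finite $Y\subseteq X$, every automorphism of $L(Y)$ extends to an automorphism of $L(X)$ that is the identity on $L(X\setminus Y)$. Let $\mathrm{AL}_f(X)$ be the group of all $\beta\in\mathrm{Aut}(L(X))$ such that, for some finite $Y\subseteq X$, $\beta(L(Y))=L(Y)$ and $\beta$ is the identity on $L(X\setminus Y)$. An action of $\Gamma$ on $X$ (by graph automorphisms, in the graph case) induces by functoriality an action on $L(X)$, hence, by conjugation, an action on $\mathrm{AL}_f(X)$; the \emph{automorphic enrichment} is $\mathcal{AL}(\Gamma,X)=\mathrm{AL}_f(X)\rtimes\Gamma$. \textbf{Theorem.} Let $\mathcal{C}$ be the class of sofic groups, of $\mathbb{K}$-linear sofic groups for a field $\mathbb{K}$,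 of hyperlinear groups, or of weakly sofic groups. Let $\Gamma\in\mathcal{C}$ have a sofic action on a set (respectively graph) $X$, and let $\mathcal{L}$ be a set-theoretic (respectively graph-theoretic) halo of groups satisfying (a) and (b). If $\mathrm{AL}_f(X)\in\mathcal{C}$, then $\mathcal{AL}(\Gamma,X)\in\mathcal{C}$. In particular, if $L(Y)$ is finitely generated and residually finite for every finite subset (respectively finite induced subgraph) $Y\subseteq X$, then $\mathrm{AL}_f(X)\in\mathcal{C}$ and $\mathcal{AL}(\Gamma,X)\in\mathcal{C}$. -/

import Mathlib

open scoped Pointwise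

universe u v w k

/-! ## Metric approximations of groups -/

/-- `φ : Γ → G` is `(F, ε)`-multiplicative with respect to the distance function `d` on `G`. -/
def IsMultiplicativeOn {Γ : Type*} [Group Γ] {G : Type*} [Group G] (d : G → G → ℝ)
    (F : Finset Γ) (ε : ℝ) (φ : Γ → G) : Prop :=
  ∀ g ∈ F, ∀ h ∈ F, g * h ∈ F → d (φ (g * h)) (φ g * φ h) < ε

/-- `φ : Γ → G` is `(F, c)`-separating with respect to the distance function `d` on `G`. -/
def IsSeparatingOn {Γ : Type*} [Group Γ] {G : Type*} [Group G] (d : G → G → ℝ)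
    (F : Finset Γ) (c : ℝ) (φ : Γ → G) : Prop :=
  ∀ g ∈ F, g ≠ 1 → c < d (φ g) 1

/-- A family of groups, each of them with a distance function. (The four families used below
consist of bounded bi-invariant metrics.) -/
structure MetricFamily where
  /-- the index set -/
  Idx : Type u
  /-- the groups -/
  carrier : Idx → Type v
  /-- the group structures -/
  group : ∀ i, Group (carrier i)
  /-- the distance functions -/
  d : ∀ i, carrier i → carrier i → ℝ

/-- `Γ` is `𝒢`-approximable: for some `c > 0`, for all finite `F ⊆ Γ` and `ε > 0` there is a unital,
`(F, ε)`-multiplicative, `(F, c)`-separating map from `Γ` to a member of `𝒢`. -/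
def IsApproximable (𝒢 : MetricFamily.{u, v}) (Γ : Type w) [Group Γ] : Prop :=
  ∃ c : ℝ, 0 < c ∧ ∀ (F : Finset Γ) (ε : ℝ), 0 < ε →
    ∃ i : 𝒢.Idx,
      letI := 𝒢.group i
      ∃ φ : Γ → 𝒢.carrier i,
        φ 1 = 1 ∧ IsMultiplicativeOn (𝒢.d i) F ε φ ∧ IsSeparatingOn (𝒢.d i) F c φ

/-- The normalized Hamming metric on `Sym(A)`: the proportion of the points of `A` at which two
permutations differ. -/
noncomputable def permDist {A : Type*} [Fintype A] (σ τ : Equiv.Perm A) : ℝ :=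
  (Nat.card {a : A // σ a ≠ τ a} : ℝ) / Fintype.card A

/-- The normalized rank metric on `GL_n(K)`. -/
noncomputable def rankDist {K : Type*} [Field K] {n : ℕ} (M N : GL (Fin n) K) : ℝ :=
  (((M : Matrix (Fin n) (Fin n) K) - (N : Matrix (Fin n) (Fin n) K)).rank : ℝ) / n

/-- The normalized Hilbert-Schmidt metric on `U(n)`. -/
noncomputable def hsDist {n : ℕ} (A B : Matrix.unitaryGroup (Fin n) ℂ) : ℝ :=
  Real.sqrt ((∑ i, ∑ j,
    ‖(A : Matrix (Fin n) (Fin n) ℂ) i j - (B : Matrix (Fin n) (Fin n) ℂ) i j‖ ^ 2) / n)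

/-- The finite symmetric groups `Sym(n)`, `n ≥ 1`, with the normalized Hamming metric. -/
noncomputable def symFamily : MetricFamily.{0, 0} where
  Idx := ℕ+
  carrier n := Equiv.Perm (Fin n)
  group _ := inferInstance
  d _ := permDist

/-- The groups `GL_n(K)`, `n ≥ 1`, with the normalized rank metric. -/
noncomputable def glFamily (K : Type k) [Field K] : MetricFamily.{0, k} where
  Idx := ℕ+
  carrier n := GL (Fin n) K
  group _ := inferInstance
  d _ := rankDist

/-- The unitary groups `U(n)`, `n ≥ 1`, with the normalized Hilbert-Schmidt metric. -/
noncomputable def unitaryFamily : MetricFamily.{0, 0} where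
  Idx := ℕ+
  carrier n := Matrix.unitaryGroup (Fin n) ℂ
  group _ := inferInstance
  d _ := hsDist

/-- A finite group with a bi-invariant metric of diameter one. -/
structure FiniteMetricGroup where
  /-- the group -/
  carrier : Type
  [group : Group carrier]
  [finite : Finite carrier]
  /-- the metric -/
  d : carrier → carrier → ℝ
  eq_iff : ∀ x y, d x y = 0 ↔ x = y
  symm : ∀ x y, d x y = d y x
  triangle : ∀ x y z, d x z ≤ d x y + d y z
  mul_left : ∀ z x y, d (z * x) (z * y) = d x y
  mul_right : ∀ z x y, d (x * z) (y * z) = d x y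
  le_one : ∀ x y, d x y ≤ 1
  exists_eq_one : ∃ x y, d x y = 1

/-- All finite groups with bi-invariant metrics of diameter one. -/
def finiteFamily : MetricFamily.{1, 0} where
  Idx := FiniteMetricGroup
  carrier H := H.carrier
  group H := H.group
  d H := H.d

/-- The four classes of groups: sofic, `K`-linear sofic for a field `K`, hyperlinear,
weakly sofic. -/
inductive GroupClass : Type (k + 1)
  | sofic : GroupClass
  | linearSofic (K : Type k) [Field K] : GroupClass
  | hyperlinear : GroupClass
  | weaklySofic : GroupClass

/-- The group `Γ` belongs to the class. -/
def GroupClass.Mem : GroupClass.{k} → ∀ (Γ : Type w) [Group Γ], Prop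
  | .sofic, Γ, _ => IsApproximable symFamily Γ
  | @GroupClass.linearSofic K hK, Γ, _ => IsApproximable (@glFamily K hK) Γ
  | .hyperlinear, Γ, _ => IsApproximable unitaryFamily Γ
  | .weaklySofic, Γ, _ => IsApproximable finiteFamily Γ

/-! ## Sofic actions on sets and graphs -/

/-- `φ : Γ → Sym(A)` is an `(F, E, ε)`-orbit approximation of the action of `Γ` on the set `X`. -/
def IsOrbitApproximation {Γ : Type*} [Group Γ] {X : Type*} [MulAction Γ X]
    {A : Type} [Fintype A] (F : Finset Γ) (E : Finset X) (ε : ℝ) (φ : Γ → Equiv.Perm A) : Prop :=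
  ∃ (B : Type) (_ : Finite B) (S : Finset A) (π : S → ({x : X // x ∈ E} ↪ B)),
    (1 - ε) * Fintype.card A < S.card ∧
    ∀ g ∈ F, ∀ (x : X) (hx : x ∈ E) (hgx : g⁻¹ • x ∈ E) (s : A) (hs : s ∈ S) (hgs : φ g s ∈ S),
      π ⟨φ g s, hgs⟩ ⟨x, hx⟩ = π ⟨s, hs⟩ ⟨g⁻¹ • x, hgx⟩

/-- Soficity of an action of a group on a set. -/
def IsSoficAction (Γ : Type*) [Group Γ] (X : Type*) [MulAction Γ X] : Prop :=
  ∀ (F : Finset Γ) (E : Finset X) (ε : ℝ), 0 < ε →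
    ∃ (A : Type) (_ : Fintype A) (φ : Γ → Equiv.Perm A),
      φ 1 = 1 ∧ IsMultiplicativeOn permDist F ε φ ∧ IsOrbitApproximation F E ε φ

/-- The action of `Γ` on the vertices is an action by automorphisms of the graph `X`. -/
def IsGraphAction (Γ : Type*) [Group Γ] {V : Type*} [MulAction Γ V] (X : SimpleGraph V) : Prop :=
  ∀ (g : Γ) (x y : V), X.Adj (g • x) (g • y) ↔ X.Adj x y

/-- `φ : Γ → Sym(A)` is an `(F, E, ε)`-orbit approximation of the action of `Γ` on the graph `X`:
the target is a finite graph, and the injections are inclusions of induced subgraphs. -/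
def IsGraphOrbitApproximation {Γ : Type*} [Group Γ] {V : Type*} [MulAction Γ V]
    (X : SimpleGraph V) {A : Type} [Fintype A] (F : Finset Γ) (E : Finset V) (ε : ℝ)
    (φ : Γ → Equiv.Perm A) : Prop :=
  ∃ (W : Type) (_ : Finite W) (B : SimpleGraph W) (S : Finset A)
    (π : S → (X.induce {x : V | x ∈ E} ↪g B)),
    (1 - ε) * Fintype.card A < S.card ∧
    ∀ g ∈ F, ∀ (x : V) (hx : x ∈ E) (hgx : g⁻¹ • x ∈ E) (s : A) (hs : s ∈ S) (hgs : φ g s ∈ S),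
      π ⟨φ g s, hgs⟩ ⟨x, hx⟩ = π ⟨s, hs⟩ ⟨g⁻¹ • x, hgx⟩

/-- Soficity of an action of a group on a graph. -/
def IsSoficGraphAction (Γ : Type*) [Group Γ] {V : Type*} [MulAction Γ V]
    (X : SimpleGraph V) : Prop :=
  ∀ (F : Finset Γ) (E : Finset V) (ε : ℝ), 0 < ε →
    ∃ (A : Type) (_ : Fintype A) (φ : Γ → Equiv.Perm A),
      φ 1 = 1 ∧ IsMultiplicativeOn permDist F ε φ ∧ IsGraphOrbitApproximation X F E ε φ

/-! ## Haloes of groups over a fixed set, and their finitely supported automorphisms -/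

section Halo

variable {X : Type u} {G : Type v} [Group G]

/-- The family of subgroups `L(Y) ≤ G`, `Y ⊆ X`, is a halo of groups over `X` with `L(X) = G`. -/
structure IsHalo (L : Set X → Subgroup G) : Prop where
  univ : L Set.univ = ⊤
  mono : ∀ Z Y : Set X, Z ⊆ Y → L Z ≤ L Y
  empty : L ∅ = ⊥
  iSup_finite : L Set.univ = ⨆ Y : {Y : Set X // Y.Finite}, L Y
  inter : ∀ Y Z : Set X, L (Y ∩ Z) = L Y ⊓ L Z

/-- Condition (a): `L(Y ∪ Z)` is generated by `L(Y)` and `L(Z)`. -/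
def HaloCondA (L : Set X → Subgroup G) : Prop :=
  ∀ Y Z : Set X, L (Y ∪ Z) = L Y ⊔ L Z

/-- The automorphisms `β` of `G = L(X)` such that `β(L(Y)) = L(Y)` and `β` is the identity on
`L(X \ Y)`. For finite `Y` this is `AL_{f,X}(Y)`. -/
def autSupportedOn (L : Set X → Subgroup G) (Y : Set X) : Set (MulAut G) :=
  {β | (L Y).map β.toMonoidHom = L Y ∧ ∀ x ∈ L Yᶜ, β x = x}

/-- Condition (b): for finite `Y ⊆ X`, every automorphism of `L(Y)` extends to an automorphism of
`L(X)` which is the identity on `L(X \ Y)`. -/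
def HaloCondB (L : Set X → Subgroup G) : Prop :=
  ∀ Y : Set X, Y.Finite → ∀ β : MulAut (L Y),
    ∃ β' ∈ autSupportedOn L Y, ∀ x : L Y, β' (x : G) = (β x : G)

theorem autSupportedOn_mono {L : Set X → Subgroup G} (hL : IsHalo L) (ha : HaloCondA L)
    {Y Z : Set X} (hYZ : Y ⊆ Z) : autSupportedOn L Y ⊆ autSupportedOn L Z := by
  rintro β ⟨h1, h2⟩
  refine ⟨?_, fun x hx => h2 x (hL.mono _ _ (Set.compl_subset_compl.2 hYZ) hx)⟩
  have h3 : (L (Z \ Y)).map β.toMonoidHom = L (Z \ Y) := by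
    have h4 : ∀ x ∈ L (Z \ Y), β x = x := fun x hx =>
      h2 x (hL.mono _ _ (fun _ hz => hz.2) hx)
    ext x
    constructor
    · rintro ⟨y, hy, rfl⟩
      have : β.toMonoidHom y = y := h4 y hy
      rw [this]; exact hy
    · intro hx
      exact ⟨x, hx, h4 x hx⟩
  have h5 : Z = Y ∪ (Z \ Y) := (Set.union_sdiff_cancel hYZ).symm
  rw [h5, ha, Subgroup.map_sup, h1, h3]

/-- The group `AL_f(X)` of finitely supported automorphisms of `L(X)`: those `β` such that, for some
finite `Y ⊆ X`, `β(L(Y)) = L(Y)` and `β` is the identity on `L(X \ Y)`. -/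
def autFin (L : Set X → Subgroup G) (hL : IsHalo L) (ha : HaloCondA L) : Subgroup (MulAut G) where
  carrier := {β | ∃ Y : Set X, Y.Finite ∧ β ∈ autSupportedOn L Y}
  one_mem' := ⟨∅, Set.finite_empty, by
    constructor
    · exact Subgroup.map_id _
    · intro x _; rfl⟩
  mul_mem' := by
    rintro β γ ⟨Y, hY, hβ⟩ ⟨Z, hZ, hγ⟩
    refine ⟨Y ∪ Z, hY.union hZ, ?_⟩
    obtain ⟨h1, h2⟩ := autSupportedOn_mono hL ha Set.subset_union_left hβ
    obtain ⟨h3, h4⟩ := autSupportedOn_mono hL ha Set.subset_union_right hγ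
    refine ⟨?_, fun x hx => ?_⟩
    · have : (β * γ).toMonoidHom = β.toMonoidHom.comp γ.toMonoidHom := rfl
      rw [this, ← Subgroup.map_map, h3, h1]
    · rw [MulAut.mul_apply, h4 x hx, h2 x hx]
  inv_mem' := by
    rintro β ⟨Y, hY, h1, h2⟩
    refine ⟨Y, hY, ?_, fun x hx => ?_⟩
    · have : (β⁻¹).toMonoidHom.comp β.toMonoidHom = MonoidHom.id G := by
        ext x; exact MulAut.inv_apply_self _ _ _
      conv_lhs => rw [← h1]
      rw [Subgroup.map_map, this, Subgroup.map_id]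
    · conv_lhs => rw [← h2 x hx]
      exact MulAut.inv_apply_self _ _ _

variable {Γ : Type w} [Group Γ] [MulAction Γ X]

theorem conj_mem_autFin {L : Set X → Subgroup G} (hL : IsHalo L) (ha : HaloCondA L)
    (a : Γ →* MulAut G) (h : ∀ (g : Γ) (Y : Set X), (L Y).map (a g).toMonoidHom = L (g • Y))
    (g : Γ) {β : MulAut G} (hβ : β ∈ autFin L hL ha) : a g * β * (a g)⁻¹ ∈ autFin L hL ha := by
  obtain ⟨Y, hY, h1, h2⟩ := hβ
  refine ⟨g • Y, hY.smul_set, ?_, fun x hx => ?_⟩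
  · have e : (a g * β * (a g)⁻¹).toMonoidHom.comp (a g).toMonoidHom =
        (a g).toMonoidHom.comp β.toMonoidHom := by
      ext x
      change a g (β ((a g)⁻¹ (a g x))) = a g (β x)
      rw [MulAut.inv_apply_self]
    rw [← h g Y, Subgroup.map_map, e, ← Subgroup.map_map, h1]
  · rw [← Set.smul_set_compl, ← h g Yᶜ] at hx
    obtain ⟨y, hy, rfl⟩ := hx
    change a g (β ((a g)⁻¹ (a g y))) = a g y
    rw [MulAut.inv_apply_self, h2 y hy]

/-- The action of `Γ` on `AL_f(X)` by conjugation, induced by an action `a` of `Γ` on `L(X)` with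
`a(g)(L(Y)) = L(gY)`. -/
def autFinAction (L : Set X → Subgroup G) (hL : IsHalo L) (ha : HaloCondA L)
    (a : Γ →* MulAut G) (h : ∀ (g : Γ) (Y : Set X), (L Y).map (a g).toMonoidHom = L (g • Y)) :
    Γ →* MulAut (autFin L hL ha) where
  toFun g :=
    { toFun := fun β => ⟨a g * β * (a g)⁻¹, conj_mem_autFin hL ha a h g β.2⟩
      invFun := fun β => ⟨a g⁻¹ * β * (a g⁻¹)⁻¹, conj_mem_autFin hL ha a h g⁻¹ β.2⟩
      left_inv := fun β => Subtype.ext (by simp [mul_assoc])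
      right_inv := fun β => Subtype.ext (by simp [mul_assoc])
      map_mul' := fun β γ => Subtype.ext (by simp [mul_assoc]) }
  map_one' := by ext β; simp
  map_mul' g₁ g₂ := by ext β; simp [mul_assoc]

end Halo

/-! ## Set-theoretic haloes -/

/-- A set-theoretic halo of groups: a functor from sets and injections to groups and monomorphisms,
such that over every set `X` the images of the `L(Y)`, `Y ⊆ X`, form a halo of groups. -/
structure SetHalo where
  /-- the group `L(X)` -/
  obj : Type u → Type v
  [group : ∀ X, Group (obj X)]
  /-- the homomorphism induced by an injection -/
  map : ∀ {Y X : Type u}, (Y ↪ X) → (obj Y →* obj X)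
  map_injective : ∀ {Y X : Type u} (f : Y ↪ X), Function.Injective (map f)
  map_refl : ∀ X : Type u, map (Function.Embedding.refl X) = MonoidHom.id (obj X)
  map_trans : ∀ {Z Y X : Type u} (f : Z ↪ Y) (g : Y ↪ X),
    map (f.trans g) = (map g).comp (map f)
  isHalo : ∀ X : Type u,
    IsHalo fun Y : Set X => (map (Function.Embedding.subtype fun x => x ∈ Y)).range

attribute [instance] SetHalo.group

namespace SetHalo

variable (𝓛 : SetHalo.{u, v})

/-- The subgroup `L(Y) ≤ L(X)` for `Y ⊆ X`. -/
def sub {X : Type u} (Y : Set X) : Subgroup (𝓛.obj X) :=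
  (𝓛.map (Function.Embedding.subtype fun x => x ∈ Y)).range

/-- Condition (a), over every set. -/
def CondA : Prop := ∀ X : Type u, HaloCondA (𝓛.sub (X := X))

/-- Condition (b), over every set. -/
def CondB : Prop := ∀ X : Type u, HaloCondB (𝓛.sub (X := X))

/-- The automorphism of `L(X)` induced by a permutation of `X`. -/
def mapEquiv {X : Type u} (e : X ≃ X) : MulAut (𝓛.obj X) where
  toFun := 𝓛.map e.toEmbedding
  invFun := 𝓛.map e.symm.toEmbedding
  left_inv x := by
    rw [← MonoidHom.comp_apply, ← 𝓛.map_trans]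
    have : e.toEmbedding.trans e.symm.toEmbedding = Function.Embedding.refl X := by ext; simp
    rw [this, 𝓛.map_refl]; rfl
  right_inv x := by
    rw [← MonoidHom.comp_apply, ← 𝓛.map_trans]
    have : e.symm.toEmbedding.trans e.toEmbedding = Function.Embedding.refl X := by ext; simp
    rw [this, 𝓛.map_refl]; rfl
  map_mul' := map_mul _

/-- The action of `Γ` on `L(X)` induced by an action on `X`. -/
def action (Γ : Type w) [Group Γ] (X : Type u) [MulAction Γ X] : Γ →* MulAut (𝓛.obj X) where
  toFun g := 𝓛.mapEquiv (MulAction.toPerm g)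
  map_one' := by
    ext x
    change 𝓛.map (MulAction.toPerm (1 : Γ)).toEmbedding x = x
    have : (MulAction.toPerm (1 : Γ)).toEmbedding = Function.Embedding.refl X := by ext; simp
    rw [this, 𝓛.map_refl]; rfl
  map_mul' g h := by
    ext x
    change 𝓛.map (MulAction.toPerm (g * h)).toEmbedding x =
      𝓛.map (MulAction.toPerm g).toEmbedding (𝓛.map (MulAction.toPerm h).toEmbedding x)
    have : (MulAction.toPerm (g * h) : Equiv.Perm X).toEmbedding =
        (MulAction.toPerm h).toEmbedding.trans (MulAction.toPerm g).toEmbedding := by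
      ext; simp [mul_smul]
    rw [this, 𝓛.map_trans]; rfl

theorem action_map_sub (Γ : Type w) [Group Γ] (X : Type u) [MulAction Γ X] (g : Γ) (Y : Set X) :
    (𝓛.sub Y).map (𝓛.action Γ X g).toMonoidHom = 𝓛.sub (g • Y) := by
  have key : ∀ (g : Γ) (Y : Set X),
      (𝓛.sub Y).map (𝓛.action Γ X g).toMonoidHom ≤ 𝓛.sub (g • Y) := by
    rintro g Y _ ⟨_, ⟨y, rfl⟩, rfl⟩
    let f : Y ↪ (g • Y : Set X) :=
      ⟨fun y => ⟨g • (y : X), Set.smul_mem_smul_set y.2⟩, fun a b hab => by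
        simpa [Subtype.ext_iff] using hab⟩
    refine ⟨𝓛.map f y, ?_⟩
    change 𝓛.map _ (𝓛.map f y) = 𝓛.map (MulAction.toPerm g).toEmbedding (𝓛.map _ y)
    rw [← MonoidHom.comp_apply, ← MonoidHom.comp_apply, ← 𝓛.map_trans, ← 𝓛.map_trans]
    rfl
  refine le_antisymm (key g Y) fun x hx => ?_
  refine ⟨𝓛.action Γ X g⁻¹ x, ?_, ?_⟩
  · have := key g⁻¹ (g • Y) ⟨x, hx, rfl⟩
    rwa [inv_smul_smul] at this
  · change 𝓛.action Γ X g (𝓛.action Γ X g⁻¹ x) = x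
    rw [← MulAut.mul_apply, ← map_mul]; simp

/-- The group `AL_f(X)`. -/
abbrev AutFin (ha : 𝓛.CondA) (X : Type u) : Type v :=
  autFin (𝓛.sub (X := X)) (𝓛.isHalo X) (ha X)

/-- The automorphic enrichment `AL_f(X) ⋊ Γ` of an action of `Γ` on `X`. -/
abbrev AutEnrichment (ha : 𝓛.CondA) (Γ : Type w) [Group Γ] (X : Type u) [MulAction Γ X] :
    Type (max v w) :=
  𝓛.AutFin ha X ⋊[autFinAction (𝓛.sub (X := X)) (𝓛.isHalo X) (ha X) (𝓛.action Γ X)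
    (𝓛.action_map_sub Γ X)] Γ

end SetHalo

/-! ## Graph-theoretic haloes -/

/-- A graph-theoretic halo of groups: a functor from graphs and inclusions of induced subgraphs to
groups and monomorphisms, such that over every graph `X` the images of the `L(Y)`, `Y` an induced
subgraph of `X`, form a halo of groups. -/
structure GraphHalo where
  /-- the group `L(X)` -/
  obj : ∀ {V : Type u}, SimpleGraph V → Type v
  [group : ∀ {V : Type u} (X : SimpleGraph V), Group (obj X)]
  /-- the homomorphism induced by an inclusion of an induced subgraph -/
  map : ∀ {W V : Type u} {Y : SimpleGraph W} {X : SimpleGraph V}, (Y ↪g X) → (obj Y →* obj X)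
  map_injective : ∀ {W V : Type u} {Y : SimpleGraph W} {X : SimpleGraph V} (f : Y ↪g X),
    Function.Injective (map f)
  map_refl : ∀ {V : Type u} (X : SimpleGraph V),
    map (SimpleGraph.Embedding.refl (G := X)) = MonoidHom.id (obj X)
  map_comp : ∀ {U W V : Type u} {Z : SimpleGraph U} {Y : SimpleGraph W} {X : SimpleGraph V}
    (g : Y ↪g X) (f : Z ↪g Y), map (g.comp f) = (map g).comp (map f)
  isHalo : ∀ {V : Type u} (X : SimpleGraph V),
    IsHalo fun Y : Set V => (map (SimpleGraph.Embedding.induce (G := X) Y)).range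

attribute [instance] GraphHalo.group

namespace GraphHalo

variable (𝓛 : GraphHalo.{u, v})

/-- The subgroup `L(Y) ≤ L(X)` for the subgraph `Y` of `X` induced on a set of vertices. -/
def sub {V : Type u} (X : SimpleGraph V) (Y : Set V) : Subgroup (𝓛.obj X) :=
  (𝓛.map (SimpleGraph.Embedding.induce (G := X) Y)).range

/-- Condition (a), over every graph. -/
def CondA : Prop := ∀ (V : Type u) (X : SimpleGraph V), HaloCondA (𝓛.sub X)

/-- Condition (b), over every graph. -/
def CondB : Prop := ∀ (V : Type u) (X : SimpleGraph V), HaloCondB (𝓛.sub X)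

/-- The automorphism of `L(X)` induced by an automorphism of `X`. -/
def mapIso {V : Type u} {X : SimpleGraph V} (e : X ≃g X) : MulAut (𝓛.obj X) where
  toFun := 𝓛.map e.toEmbedding
  invFun := 𝓛.map e.symm.toEmbedding
  left_inv x := by
    rw [← MonoidHom.comp_apply, ← 𝓛.map_comp]
    have : e.symm.toEmbedding.comp e.toEmbedding = SimpleGraph.Embedding.refl (G := X) := by
      ext; simp
    rw [this, 𝓛.map_refl]; rfl
  right_inv x := by
    rw [← MonoidHom.comp_apply, ← 𝓛.map_comp]
    have : e.toEmbedding.comp e.symm.toEmbedding = SimpleGraph.Embedding.refl (G := X) := by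
      ext; simp
    rw [this, 𝓛.map_refl]; rfl
  map_mul' := map_mul _

/-- The graph automorphism given by an element of a group acting on the graph. -/
def actIso {Γ : Type w} [Group Γ] {V : Type u} [MulAction Γ V] {X : SimpleGraph V}
    (hX : IsGraphAction Γ X) (g : Γ) : X ≃g X where
  toEquiv := MulAction.toPerm g
  map_rel_iff' := fun {x y} => hX g x y

/-- The action of `Γ` on `L(X)` induced by an action on the graph `X`. -/
def action {Γ : Type w} [Group Γ] {V : Type u} [MulAction Γ V] {X : SimpleGraph V}
    (hX : IsGraphAction Γ X) : Γ →* MulAut (𝓛.obj X) where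
  toFun g := 𝓛.mapIso (actIso hX g)
  map_one' := by
    ext x
    change 𝓛.map (actIso hX 1).toEmbedding x = x
    have : (actIso hX 1).toEmbedding = SimpleGraph.Embedding.refl (G := X) := by
      ext v; exact one_smul Γ v
    rw [this, 𝓛.map_refl]; rfl
  map_mul' g h := by
    ext x
    change 𝓛.map (actIso hX (g * h)).toEmbedding x =
      𝓛.map (actIso hX g).toEmbedding (𝓛.map (actIso hX h).toEmbedding x)
    have : (actIso hX (g * h)).toEmbedding =
        (actIso hX g).toEmbedding.comp (actIso hX h).toEmbedding := by
      ext v; exact mul_smul g h v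
    rw [this, 𝓛.map_comp]; rfl

theorem action_map_sub {Γ : Type w} [Group Γ] {V : Type u} [MulAction Γ V] {X : SimpleGraph V}
    (hX : IsGraphAction Γ X) (g : Γ) (Y : Set V) :
    (𝓛.sub X Y).map (𝓛.action hX g).toMonoidHom = 𝓛.sub X (g • Y) := by
  have key : ∀ (g : Γ) (Y : Set V),
      (𝓛.sub X Y).map (𝓛.action hX g).toMonoidHom ≤ 𝓛.sub X (g • Y) := by
    rintro g Y _ ⟨_, ⟨y, rfl⟩, rfl⟩
    let f : X.induce Y ↪g X.induce (g • Y : Set V) :=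
      { toFun := fun y => ⟨g • (y : V), Set.smul_mem_smul_set y.2⟩
        inj' := fun a b hab => by simpa [Subtype.ext_iff] using hab
        map_rel_iff' := fun {a b} => hX g a b }
    refine ⟨𝓛.map f y, ?_⟩
    change 𝓛.map _ (𝓛.map f y) = 𝓛.map (actIso hX g).toEmbedding (𝓛.map _ y)
    rw [← MonoidHom.comp_apply, ← MonoidHom.comp_apply, ← 𝓛.map_comp, ← 𝓛.map_comp]
    rfl
  refine le_antisymm (key g Y) fun x hx => ?_
  refine ⟨𝓛.action hX g⁻¹ x, ?_, ?_⟩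
  · have := key g⁻¹ (g • Y) ⟨x, hx, rfl⟩
    rwa [inv_smul_smul] at this
  · change 𝓛.action hX g (𝓛.action hX g⁻¹ x) = x
    rw [← MulAut.mul_apply, ← map_mul]; simp

/-- The group `AL_f(X)`. -/
abbrev AutFin (ha : 𝓛.CondA) {V : Type u} (X : SimpleGraph V) : Type v :=
  autFin (𝓛.sub X) (𝓛.isHalo X) (ha V X)

/-- The automorphic enrichment `AL_f(X) ⋊ Γ` of an action of `Γ` on the graph `X`. -/
abbrev AutEnrichment (ha : 𝓛.CondA) {Γ : Type w} [Group Γ] {V : Type u} [MulAction Γ V]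
    {X : SimpleGraph V} (hX : IsGraphAction Γ X) : Type (max v w) :=
  𝓛.AutFin ha X ⋊[autFinAction (𝓛.sub X) (𝓛.isHalo X) (ha V X) (𝓛.action hX)
    (𝓛.action_map_sub hX)] Γ

end GraphHalo

/-!
By condition (a), an automorphism of `L(X)` that permutes the groups `L({x})` through a permutation
`σ` of `X` conjugates an automorphism supported on a finite set `Y` in a way that depends only on
`σ|_Y`. Transpositions of points lift to such automorphisms, by functoriality over sets and by
condition (b) over graphs, where they need not be graph automorphisms. Hence injections of finite
subsets into `X` act on finite parts of `AL_f(X)`, and a sofic action of `Γ` on `X` provides almost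
multiplicative permutations `φ g` of finite sets `A` and automorphisms `θ a` of `AL_f(X)`, `a ∈ A`,
such that `θ (φ g a) (g • β) = θ a β` for most `a`.

If `χ : AL_f(X) → G` is almost multiplicative, then so is the map sending `(β, g)` to
`((χ (θ a β))_a, φ g)` in the permutational wreath product `G ≀ Sym(A)`. Together with an
approximation of `Γ`, which separates the elements with `g ≠ 1`, this approximates
`AL_f(X) ⋊ Γ`, since each of the four families is closed under wreath products with `Sym(A)` and
under products, up to embeddings that control the metrics.

When the groups `L(Y)`, `Y` finite, are finitely generated and residually finite, Baumslag's theorem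
makes their automorphism groups residually finite, so `AL_f(X)` is a directed union of residually
finite groups and embeds locally into finite groups.
-/

attribute [instance] MetricFamily.group FiniteMetricGroup.group FiniteMetricGroup.finite

/-! ## Permutational wreath products -/

/-- The permutational wreath product `G ≀ Sym(A)`, in which `Sym(A)` acts on the functions `A → G`
by `(σ • f) a = f (σ⁻¹ a)`. Its elements are thought of as block monomial matrices, with rows and
columns indexed by `A`. -/
abbrev PermWreath (A G : Type*) [Group G] : Type _ :=
  (A → G) ⋊[mulAutArrow] Equiv.Perm A

namespace PermWreath

open SemidirectProduct (inl inr)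

section Block

variable {A G : Type*} [Group G]

/-- The only nontrivial block in column `a` of the monomial matrix `x`; it stands in row
`x.right a`, while `x.left` is indexed by rows. -/
def block (x : PermWreath A G) (a : A) : G := x.left (x.right a)

@[simp]
theorem block_one (a : A) : block (1 : PermWreath A G) a = 1 := rfl

theorem block_mul (x y : PermWreath A G) (a : A) :
    (x * y).block a = x.block (y.right a) * y.block a := by
  change x.left (x.right (y.right a)) * y.left (x.right.symm (x.right (y.right a))) = _
  rw [Equiv.symm_apply_apply]
  rfl

@[simp]
theorem block_inl (f : A → G) (a : A) : block (inl f) a = f a := rfl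

@[simp]
theorem block_inr (σ : Equiv.Perm A) (a : A) : block (inr σ : PermWreath A G) a = 1 := rfl

theorem ext_block {x y : PermWreath A G} (hright : ∀ a, x.right a = y.right a)
    (hblock : ∀ a, x.block a = y.block a) : x = y := by
  have h : x.right = y.right := Equiv.ext hright
  refine SemidirectProduct.ext (funext fun a => ?_) h
  simpa [block, ← h] using hblock (x.right⁻¹ a)

instance [Finite A] [Finite G] : Finite (PermWreath A G) :=
  Finite.of_equiv _ SemidirectProduct.equivProd.symm

open Classical in
/-- The distance between the columns of index `a` of two monomial matrices, which is `1` when their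
blocks stand in different rows. -/
noncomputable def columnDist (d : G → G → ℝ) (x y : PermWreath A G) (a : A) : ℝ :=
  if x.right a = y.right a then d (x.block a) (y.block a) else 1

theorem columnDist_of_eq (d : G → G → ℝ) {x y : PermWreath A G} {a : A}
    (h : x.right a = y.right a) : columnDist d x y a = d (x.block a) (y.block a) :=
  if_pos h

theorem columnDist_of_ne (d : G → G → ℝ) {x y : PermWreath A G} {a : A}
    (h : x.right a ≠ y.right a) : columnDist d x y a = 1 :=
  if_neg h

theorem columnDist_le {d : G → G → ℝ} {C : ℝ} (hC : 1 ≤ C) (hd : ∀ g h, d g h ≤ C)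
    (x y : PermWreath A G) (a : A) : columnDist d x y a ≤ C := by
  rw [columnDist]
  split_ifs
  exacts [hd _ _, hC]

end Block

variable {A G : Type*} [Fintype A] [Group G]

/-- The distance on the wreath product induced by a distance on `G`: the average of the distances
between the columns. -/
noncomputable def wreathDist (d : G → G → ℝ) (x y : PermWreath A G) : ℝ :=
  (∑ a, columnDist d x y a) / Fintype.card A

theorem wreathDist_inl (d : G → G → ℝ) (f f' : A → G) :
    wreathDist d (inl f : PermWreath A G) (inl f') =
      (∑ a, d (f a) (f' a)) / Fintype.card A := by
  simp only [wreathDist, columnDist_of_eq d (x := inl f) (y := inl f') rfl, block_inl]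

theorem wreathDist_inl_const [Nonempty A] (d : G → G → ℝ) (x y : G) :
    wreathDist d (inl fun _ : A => x : PermWreath A G) (inl fun _ => y) = d x y := by
  rw [wreathDist_inl, Finset.sum_const, nsmul_eq_mul, Finset.card_univ,
    mul_div_cancel_left₀ _ (Nat.cast_ne_zero.2 Fintype.card_ne_zero)]

theorem wreathDist_le_of_exceptional {d : G → G → ℝ} {x y : PermWreath A G} {δ C : ℝ}
    (hδ : 0 ≤ δ) (T : Finset A) (hT : ∀ a ∉ T, columnDist d x y a ≤ δ)
    (hC : ∀ a, columnDist d x y a ≤ C) :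
    wreathDist d x y ≤ δ + C * (T.card / Fintype.card A) := by
  classical
  have hsum : ∑ a, columnDist d x y a ≤ C * T.card + δ * Fintype.card A := by
    calc ∑ a, columnDist d x y a
        = ∑ a ∈ T, columnDist d x y a + ∑ a ∈ Tᶜ, columnDist d x y a :=
          (Finset.sum_add_sum_compl T _).symm
      _ ≤ T.card • C + Tᶜ.card • δ :=
          add_le_add (Finset.sum_le_card_nsmul _ _ _ fun a _ => hC a)
            (Finset.sum_le_card_nsmul _ _ _ fun a ha => hT a (Finset.mem_compl.1 ha))
      _ ≤ C * T.card + δ * Fintype.card A := by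
          rw [nsmul_eq_mul, nsmul_eq_mul, mul_comm C, mul_comm δ]
          gcongr
          exact Finset.card_le_univ _
  rcases isEmpty_or_nonempty A with hA | hA
  · simpa [wreathDist] using hδ
  · have hcard : (0 : ℝ) < Fintype.card A := Nat.cast_pos.2 Fintype.card_pos
    rw [wreathDist, div_le_iff₀ hcard]
    field_simp
    linarith

end PermWreath

open PermWreath
open SemidirectProduct (inl inr)

/-! ## Families of groups closed under wreath products -/

/-- `W` realizes the wreath product `G ≀ Sym(A)` in a group `H` with a distance function: it does
not increase distances, and is isometric on pairs `(inl f, 1)`. -/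
structure IsWreathEmbedding {A G H : Type*} [Fintype A] [Group G] [Group H] (dG : G → G → ℝ)
    (dH : H → H → ℝ) (W : PermWreath A G →* H) : Prop where
  dist_le : ∀ x y, dH (W x) (W y) ≤ wreathDist dG x y
  le_dist : ∀ f : A → G, wreathDist dG (inl f) 1 ≤ dH (W (inl f)) 1

/-- A family of groups with distance functions bounded by `2` which is closed, up to embeddings
that control the distances, under wreath products with finite symmetric groups and under binary
products, and contains the finite groups. -/
structure MetricFamily.IsWreathClosed (𝒢 : MetricFamily.{u, v}) : Prop where
  le_two : ∀ i x y, 𝒢.d i x y ≤ 2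
  self_eq_zero : ∀ i x, 𝒢.d i x x = 0
  wreath : ∀ (i : 𝒢.Idx) (A : Type) [Fintype A] [Nonempty A],
    ∃ (j : 𝒢.Idx) (W : PermWreath A (𝒢.carrier i) →* 𝒢.carrier j),
      IsWreathEmbedding (𝒢.d i) (𝒢.d j) W
  prod : ∀ i j : 𝒢.Idx, ∃ (l : 𝒢.Idx) (ι : 𝒢.carrier i × 𝒢.carrier j →* 𝒢.carrier l),
    (∀ x y, 𝒢.d l (ι x) (ι y) ≤ 𝒢.d i x.1 y.1 + 𝒢.d j x.2 y.2) ∧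
    ∀ x, 𝒢.d i x.1 1 / 2 ≤ 𝒢.d l (ι x) 1 ∧ 𝒢.d j x.2 1 / 2 ≤ 𝒢.d l (ι x) 1
  finite : ∀ (Q : Type) [Group Q] [Finite Q], ∃ (l : 𝒢.Idx) (ι : Q →* 𝒢.carrier l),
    ∀ q, q ≠ 1 → 1 / 2 ≤ 𝒢.d l (ι q) 1

theorem IsWreathEmbedding.dist_const_le {A G H : Type*} [Fintype A] [Nonempty A] [Group G]
    [Group H] {dG : G → G → ℝ} {dH : H → H → ℝ} {W : PermWreath A G →* H}
    (hW : IsWreathEmbedding dG dH W) (x y : G) :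
    dH (W (inl fun _ => x)) (W (inl fun _ => y)) ≤ dG x y :=
  (hW.dist_le _ _).trans_eq (wreathDist_inl_const dG x y)

theorem IsWreathEmbedding.le_dist_const {A G H : Type*} [Fintype A] [Nonempty A] [Group G]
    [Group H] {dG : G → G → ℝ} {dH : H → H → ℝ} {W : PermWreath A G →* H}
    (hW : IsWreathEmbedding dG dH W) (x : G) : dG x 1 ≤ dH (W (inl fun _ => x)) 1 :=
  (wreathDist_inl_const (A := A) dG x 1).symm.trans_le (hW.le_dist _)

theorem IsWreathEmbedding.lt_dist {A G H : Type*} [Fintype A] [Nonempty A] [Group G] [Group H]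
    {dG : G → G → ℝ} {dH : H → H → ℝ} {W : PermWreath A G →* H} (hW : IsWreathEmbedding dG dH W)
    {c : ℝ} {f : A → G} (hf : ∀ a, c < dG (f a) 1) : c < dH (W (inl f)) 1 := by
  refine lt_of_lt_of_le ?_ (hW.le_dist f)
  rw [← map_one inl, wreathDist_inl, lt_div_iff₀ (Nat.cast_pos.2 Fintype.card_pos), mul_comm,
    ← nsmul_eq_mul, ← Finset.card_univ, ← Finset.sum_const]
  exact Finset.sum_lt_sum_of_nonempty Finset.univ_nonempty fun a _ => hf a

/-! ## Metric approximations of semidirect products -/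

namespace IsApproximable

theorem of_jointly_separating {𝒢 : MetricFamily.{u, v}} (h𝒢 : 𝒢.IsWreathClosed) {Λ : Type w}
    [Group Λ] {c : ℝ} (hc : 0 < c)
    (h : ∀ (F : Finset Λ) (ε : ℝ), 0 < ε →
      ∃ (i j : 𝒢.Idx) (φ : Λ → 𝒢.carrier i) (ψ : Λ → 𝒢.carrier j),
        (φ 1 = 1 ∧ IsMultiplicativeOn (𝒢.d i) F ε φ) ∧
        (ψ 1 = 1 ∧ IsMultiplicativeOn (𝒢.d j) F ε ψ) ∧
        ∀ x ∈ F, x ≠ 1 → c < 𝒢.d i (φ x) 1 ∨ c < 𝒢.d j (ψ x) 1) :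
    IsApproximable 𝒢 Λ := by
  refine ⟨c / 2, half_pos hc, fun F ε hε => ?_⟩
  obtain ⟨i, j, φ, ψ, ⟨hφ1, hφ⟩, ⟨hψ1, hψ⟩, hsep⟩ := h F (ε / 2) (half_pos hε)
  obtain ⟨l, ι, hι_le, hι_ge⟩ := h𝒢.prod i j
  refine ⟨l, fun x => ι (φ x, ψ x), ?_, fun x hx y hy hxy => ?_, fun x hx hx1 => ?_⟩
  · change ι (φ 1, ψ 1) = 1
    rw [hφ1, hψ1]
    exact map_one ι
  · have hle := hι_le (φ (x * y), ψ (x * y)) ((φ x, ψ x) * (φ y, ψ y))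
    rw [map_mul] at hle
    exact hle.trans_lt <|
      (add_lt_add (hφ x hx y hy hxy) (hψ x hx y hy hxy)).trans_eq (add_halves ε)
  · obtain ⟨hge₁, hge₂⟩ := hι_ge (φ x, ψ x)
    rcases hsep x hx hx1 with h | h
    exacts [(div_lt_div_of_pos_right h two_pos).trans_le hge₁,
      (div_lt_div_of_pos_right h two_pos).trans_le hge₂]

theorem of_dist_comparison {I : Type u} {C : I → Type v} [grp : ∀ i, Group (C i)]
    {d d' : ∀ i, C i → C i → ℝ}
    (hsep : ∀ c > 0, ∃ c' > 0, ∀ i x, c < d i x 1 → c' < d' i x 1)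
    (hmul : ∀ ε > 0, ∃ δ > 0, ∀ i x y, d i x y < δ → d' i x y < ε)
    {Λ : Type w} [Group Λ] (h : IsApproximable ⟨I, C, grp, d⟩ Λ) :
    IsApproximable ⟨I, C, grp, d'⟩ Λ := by
  obtain ⟨c, hc, h⟩ := h
  obtain ⟨c', hc', hcc'⟩ := hsep c hc
  refine ⟨c', hc', fun F ε hε => ?_⟩
  obtain ⟨δ, hδ, hδε⟩ := hmul ε hε
  obtain ⟨i, φ, hφ1, hφ, hφsep⟩ := h F δ hδ
  exact ⟨i, φ, hφ1, fun x hx y hy hxy => hδε i _ _ (hφ x hx y hy hxy),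
    fun x hx hx1 => hcc' i _ (hφsep x hx hx1)⟩

end IsApproximable

/-- The action of `Γ` on `N` is approximated by permutations `φ g` of finite sets `A` and embeddings
`θ a : N → N`, `a ∈ A`, which intertwine the action with the permutations for most `a`. -/
def IsSoficAutAction {N Γ : Type*} [Group N] [Group Γ] (act : Γ →* MulAut N) : Prop :=
  ∀ (F : Finset Γ) (P : Finset N) (ε : ℝ), 0 < ε →
    ∃ (A : Type) (_ : Fintype A) (φ : Γ → Equiv.Perm A) (S : Finset A) (θ : A → N →* N),
      φ 1 = 1 ∧ IsMultiplicativeOn permDist F ε φ ∧ (1 - ε) * Fintype.card A < S.card ∧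
      (∀ a, Function.Injective (θ a)) ∧
      ∀ g ∈ F, ∀ β ∈ P, ∀ s ∈ S, φ g s ∈ S → θ (φ g s) (act g β) = θ s β

section WreathLift

variable {N Γ G A : Type*} [Group N] [Group Γ] [Group G] {act : Γ →* MulAut N}

/-- The map from `N ⋊ Γ` to a wreath product assembled from permutations `φ g` of `A`, endomorphisms
`θ a` of `N` and a map `χ : N → G`: the block in row `a` of the image of `x` is
`χ (θ a x.left)`. -/
def wreathLift (φ : Γ → Equiv.Perm A) (θ : A → N →* N) (χ : N → G) (x : N ⋊[act] Γ) :
    PermWreath A G :=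
  ⟨fun a => χ (θ a x.left), φ x.right⟩

theorem block_wreathLift (φ : Γ → Equiv.Perm A) (θ : A → N →* N) (χ : N → G) (x : N ⋊[act] Γ)
    (a : A) : (wreathLift φ θ χ x).block a = χ (θ (φ x.right a) x.left) := rfl

theorem wreathLift_one {φ : Γ → Equiv.Perm A} (hφ : φ 1 = 1) (θ : A → N →* N) {χ : N → G}
    (hχ : χ 1 = 1) : wreathLift φ θ χ (1 : N ⋊[act] Γ) = 1 :=
  SemidirectProduct.ext (funext fun a => by simp [wreathLift, hχ]) hφ

theorem wreathLift_of_right_eq_one {φ : Γ → Equiv.Perm A} (hφ : φ 1 = 1) (θ : A → N →* N)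
    (χ : N → G) {x : N ⋊[act] Γ} (hx : x.right = 1) :
    wreathLift φ θ χ x = inl fun a => χ (θ a x.left) :=
  SemidirectProduct.ext rfl (by simp [wreathLift, hx, hφ])

theorem columnDist_wreathLift_lt {d : G → G → ℝ} {φ : Γ → Equiv.Perm A} {θ : A → N →* N}
    {χ : N → G} {Q : Finset N} {δ : ℝ} (hχ : IsMultiplicativeOn d Q δ χ)
    {F : Finset (N ⋊[act] Γ)} (hQ : ∀ a, ∀ z ∈ F, θ a z.left ∈ Q) {x y : N ⋊[act] Γ}
    (hx : x ∈ F) (hy : y ∈ F) (hxy : x * y ∈ F) {a : A}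
    (hφ : φ (x * y).right a = φ x.right (φ y.right a))
    (hθ : θ (φ x.right (φ y.right a)) (act x.right y.left) = θ (φ y.right a) y.left) :
    columnDist d (wreathLift φ θ χ (x * y)) (wreathLift φ θ χ x * wreathLift φ θ χ y) a < δ := by
  have hxyQ := hQ (φ x.right (φ y.right a)) _ hxy
  rw [columnDist_of_eq d hφ, block_mul, block_wreathLift, block_wreathLift, block_wreathLift, hφ]
  rw [SemidirectProduct.mul_left, map_mul, hθ] at hxyQ ⊢
  exact hχ _ (hQ _ x hx) _ (hQ _ y hy) hxyQ

theorem wreathDist_wreathLift_le [Fintype A] {d : G → G → ℝ} (hd : ∀ g h, d g h ≤ 2)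
    {φ : Γ → Equiv.Perm A} {θ : A → N →* N} {χ : N → G} {Q : Finset N} {δ : ℝ} (hδ : 0 ≤ δ)
    (hχ : IsMultiplicativeOn d Q δ χ) {F : Finset (N ⋊[act] Γ)}
    (hQ : ∀ a, ∀ z ∈ F, θ a z.left ∈ Q) {x y : N ⋊[act] Γ} (hx : x ∈ F) (hy : y ∈ F)
    (hxy : x * y ∈ F) (T : Finset A)
    (hφ : ∀ a ∉ T, φ (x * y).right a = φ x.right (φ y.right a))
    (hθ : ∀ a ∉ T,
      θ (φ x.right (φ y.right a)) (act x.right y.left) = θ (φ y.right a) y.left) :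
    wreathDist d (wreathLift φ θ χ (x * y)) (wreathLift φ θ χ x * wreathLift φ θ χ y) ≤
      δ + 2 * (T.card / Fintype.card A) :=
  wreathDist_le_of_exceptional hδ T
    (fun a ha => (columnDist_wreathLift_lt hχ hQ hx hy hxy (hφ a ha) (hθ a ha)).le)
    (columnDist_le one_le_two hd _ _)

end WreathLift

theorem permDist_eq_card_filter_div {A : Type*} [Fintype A] [DecidableEq A]
    (σ τ : Equiv.Perm A) :
    permDist σ τ = ((Finset.univ.filter fun a => σ a ≠ τ a).card : ℝ) / Fintype.card A := by
  rw [permDist, Nat.card_eq_fintype_card, Fintype.card_subtype]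

theorem exists_exceptional_of_permDist_lt {A : Type*} [Fintype A] [Nonempty A] {S : Finset A}
    {ε : ℝ} (hS : (1 - ε) * Fintype.card A < S.card) {ρ σ τ : Equiv.Perm A}
    (hρ : permDist ρ (σ * τ) < ε) :
    ∃ T : Finset A, (T.card : ℝ) / Fintype.card A < 3 * ε ∧
      ∀ a ∉ T, ρ a = σ (τ a) ∧ τ a ∈ S ∧ σ (τ a) ∈ S := by
  classical
  have hcard : (0 : ℝ) < Fintype.card A := Nat.cast_pos.2 Fintype.card_pos
  have hSc : (Sᶜ.card : ℝ) < ε * Fintype.card A := by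
    rw [Finset.card_compl, Nat.cast_sub (Finset.card_le_univ S)]
    linarith
  let T₁ := Finset.univ.filter fun a => ρ a ≠ (σ * τ) a
  let T₂ := Sᶜ.map τ⁻¹.toEmbedding ∪ Sᶜ.map (σ * τ)⁻¹.toEmbedding
  have hT₁ : (T₁.card : ℝ) < ε * Fintype.card A := by
    rwa [permDist_eq_card_filter_div, div_lt_iff₀ hcard] at hρ
  have hT₂ : (T₂.card : ℝ) ≤ Sᶜ.card + Sᶜ.card := by
    have h := Finset.card_union_le (Sᶜ.map τ⁻¹.toEmbedding) (Sᶜ.map (σ * τ)⁻¹.toEmbedding)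
    rw [Finset.card_map, Finset.card_map] at h
    exact_mod_cast h
  refine ⟨T₁ ∪ T₂, ?_, fun a ha => ?_⟩
  · have hT : ((T₁ ∪ T₂).card : ℝ) ≤ T₁.card + T₂.card := by
      exact_mod_cast Finset.card_union_le T₁ T₂
    rw [div_lt_iff₀ hcard]
    linarith
  · simp only [T₁, T₂, Finset.mem_union, Finset.mem_filter, Finset.mem_univ, true_and,
      Finset.mem_map_equiv, Finset.mem_compl, not_or, not_not] at ha
    exact ha

namespace IsApproximable

theorem semidirectProduct {𝒢 : MetricFamily.{u, v}} (h𝒢 : 𝒢.IsWreathClosed)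
    {N : Type*} {Γ : Type*} [Group N] [Group Γ] (act : Γ →* MulAut N)
    (hN : IsApproximable 𝒢 N) (hΓ : IsApproximable 𝒢 Γ) (hact : IsSoficAutAction act) :
    IsApproximable 𝒢 (N ⋊[act] Γ) := by
  classical
  obtain ⟨c, hc, hN⟩ := hN
  obtain ⟨c', hc', hΓ⟩ := hΓ
  refine of_jointly_separating h𝒢 (lt_min hc hc') fun F ε hε => ?_
  let FΓ : Finset Γ := F.image fun x => x.right
  let P : Finset N := F.image fun x => x.left
  have hFΓ {x} (hx : x ∈ F) : x.right ∈ FΓ := Finset.mem_image_of_mem _ hx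
  have hP {x} (hx : x ∈ F) : x.left ∈ P := Finset.mem_image_of_mem _ hx
  obtain ⟨A, _, φ, S, θ, hφ1, hφ, hS, hθ, hθact⟩ := hact FΓ P (ε / 12) (by positivity)
  have : Nonempty A := by
    by_contra hA
    rw [not_nonempty_iff] at hA
    simp [Finset.eq_empty_of_isEmpty S] at hS
  let Q : Finset N := (Finset.univ ×ˢ P).image fun x : A × N => θ x.1 x.2
  have hQ (a) (x) (hx : x ∈ F) : θ a x.left ∈ Q :=
    Finset.mem_image.2 ⟨(a, x.left), Finset.mk_mem_product (Finset.mem_univ a) (hP hx), rfl⟩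
  obtain ⟨i, χ, hχ1, hχ, hχsep⟩ := hN Q (ε / 4) (by positivity)
  obtain ⟨j, ψ, hψ1, hψ, hψsep⟩ := hΓ FΓ ε hε
  obtain ⟨l, W, hW⟩ := h𝒢.wreath i A
  refine ⟨l, j, fun x => W (wreathLift φ θ χ x), fun x => ψ x.right,
    ⟨(congrArg W (wreathLift_one hφ1 θ hχ1)).trans (map_one W), fun x hx y hy hxy => ?_⟩,
    ⟨hψ1, fun x hx y hy hxy => hψ _ (hFΓ hx) _ (hFΓ hy) (hFΓ hxy)⟩, fun x hx hx1 => ?_⟩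
  · obtain ⟨T, hTcard, hT⟩ :=
      exists_exceptional_of_permDist_lt hS (hφ _ (hFΓ hx) _ (hFΓ hy) (hFΓ hxy))
    have hdist := wreathDist_wreathLift_le (h𝒢.le_two i) (by positivity) hχ hQ hx hy hxy T
      (fun a ha => (hT a ha).1) fun a ha => hθact _ (hFΓ hx) _ (hP hy) _ (hT a ha).2.1 (hT a ha).2.2
    have hW_le :=
      hW.dist_le (wreathLift φ θ χ (x * y)) (wreathLift φ θ χ x * wreathLift φ θ χ y)
    rw [map_mul] at hW_le
    linarith
  · by_cases hright : x.right = 1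
    · have hleft : x.left ≠ 1 := fun h => hx1 (SemidirectProduct.ext h hright)
      left
      beta_reduce
      rw [wreathLift_of_right_eq_one hφ1 θ χ hright]
      exact (min_le_left c c').trans_lt <| hW.lt_dist fun a => hχsep _ (hQ a x hx) <|
        (map_ne_one_iff (θ a) (hθ a)).2 hleft
    · exact Or.inr <| (min_le_right c c').trans_lt (hψsep _ (hFΓ hx) hright)

end IsApproximable

/-- `Λ` is locally embeddable into finite groups: on every finite subset it looks like a finite
group. -/
def IsLEF (Λ : Type*) [Group Λ] : Prop :=
  ∀ F : Finset Λ, ∃ (Q : Type) (_ : Group Q) (_ : Finite Q) (φ : Λ → Q), φ 1 = 1 ∧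
    (∀ x ∈ F, ∀ y ∈ F, x * y ∈ F → φ (x * y) = φ x * φ y) ∧ ∀ x ∈ F, x ≠ 1 → φ x ≠ 1

theorem IsLEF.isApproximable {𝒢 : MetricFamily.{u, v}} (h𝒢 : 𝒢.IsWreathClosed) {Λ : Type w}
    [Group Λ] (hΛ : IsLEF Λ) : IsApproximable 𝒢 Λ := by
  refine ⟨1 / 4, by norm_num, fun F ε hε => ?_⟩
  obtain ⟨Q, _, _, φ, hφ1, hφ, hφsep⟩ := hΛ F
  obtain ⟨l, ι, hι⟩ := h𝒢.finite Q
  refine ⟨l, fun x => ι (φ x), ?_, fun x hx y hy hxy => ?_, fun x hx hx1 => ?_⟩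
  · change ι (φ 1) = 1
    rw [hφ1, map_one]
  · change 𝒢.d l (ι (φ (x * y))) (ι (φ x) * ι (φ y)) < ε
    rwa [hφ x hx y hy hxy, map_mul, h𝒢.self_eq_zero]
  · exact lt_of_lt_of_le (by norm_num) (hι _ (hφsep x hx hx1))

/-! ## Families of groups indexed by their size -/

section SizeIndexed

variable {C : ℕ+ → Type v} [∀ n, Group (C n)]

/-- The groups `C n`, with distances `d n`, contain the wreath products `C n ≀ Sym(A)` in the size
`card A * n`, in such a way that fixed point free permutations are far from the identity. -/
structure IsSizeWreathClosed (d : ∀ n, C n → C n → ℝ) : Prop where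
  nonneg : ∀ n x y, 0 ≤ d n x y
  le_two : ∀ n x y, d n x y ≤ 2
  self_eq_zero : ∀ n x, d n x x = 0
  wreath : ∀ (n m : ℕ+) (A : Type) [Fintype A], (m : ℕ) = Fintype.card A * n →
    ∃ W : PermWreath A (C n) →* C m, IsWreathEmbedding (d n) (d m) W ∧
      ∀ σ : Equiv.Perm A, (∀ a, σ a ≠ a) → 1 / 2 ≤ d m (W (inr σ)) 1

namespace IsSizeWreathClosed

variable {d : ∀ n, C n → C n → ℝ}

theorem exists_monoidHom_of_dvd (h : IsSizeWreathClosed d) {n m : ℕ+} (hnm : n ∣ m) :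
    ∃ ι : C n →* C m, (∀ x y, d m (ι x) (ι y) ≤ d n x y) ∧ ∀ x, d n x 1 ≤ d m (ι x) 1 := by
  obtain ⟨k, rfl⟩ := hnm
  have : Nonempty (Fin k) := ⟨⟨0, k.pos⟩⟩
  obtain ⟨W, hW, -⟩ := h.wreath n (n * k) (Fin k) (by simp [mul_comm])
  exact ⟨W.comp (inl.comp (Pi.constMonoidHom _ _)), hW.dist_const_le, hW.le_dist_const⟩

theorem exists_prod_monoidHom (h : IsSizeWreathClosed d) (i j : ℕ+) :
    ∃ (l : ℕ+) (ι : C i × C j →* C l),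
      (∀ x y, d l (ι x) (ι y) ≤ d i x.1 y.1 + d j x.2 y.2) ∧
      ∀ x, d i x.1 1 / 2 ≤ d l (ι x) 1 ∧ d j x.2 1 / 2 ≤ d l (ι x) 1 := by
  obtain ⟨ι₁, hι₁_le, hι₁_ge⟩ := h.exists_monoidHom_of_dvd (dvd_mul_right i j)
  obtain ⟨ι₂, hι₂_le, hι₂_ge⟩ := h.exists_monoidHom_of_dvd (dvd_mul_left j i)
  obtain ⟨W, hW, -⟩ := h.wreath (i * j) (2 * (i * j)) Bool (by simp)
  let f : C i × C j →* Bool → C (i * j) := MonoidHom.pi fun b =>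
    if b then ι₁.comp (MonoidHom.fst _ _) else ι₂.comp (MonoidHom.snd _ _)
  have wreathDist_f (x y) : wreathDist (d (i * j)) (inl (f x)) (inl (f y)) =
      (d _ (ι₁ x.1) (ι₁ y.1) + d _ (ι₂ x.2) (ι₂ y.2)) / 2 := by
    rw [wreathDist_inl, Fintype.sum_bool, Fintype.card_bool]
    rfl
  refine ⟨_, W.comp (inl.comp f), fun x y => ?_, fun x => ?_⟩
  · have hle := hW.dist_le (inl (f x)) (inl (f y))
    rw [wreathDist_f] at hle
    refine hle.trans ?_
    linarith [hι₁_le x.1 y.1, hι₂_le x.2 y.2, h.nonneg i x.1 y.1, h.nonneg j x.2 y.2]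
  · have hge := hW.le_dist (f x)
    rw [← map_one inl, ← map_one f, wreathDist_f] at hge
    change _ ≤ d _ (W (inl (f x))) 1 at hge
    simp only [Prod.fst_one, Prod.snd_one, map_one] at hge
    change _ ≤ d _ (W (inl (f x))) 1 ∧ _ ≤ d _ (W (inl (f x))) 1
    constructor <;>
      linarith [hι₁_ge x.1, hι₂_ge x.2, h.nonneg i x.1 1, h.nonneg j x.2 1]

theorem exists_monoidHom_of_finite (h : IsSizeWreathClosed d) (Q : Type) [Group Q] [Finite Q] :
    ∃ (l : ℕ+) (ι : Q →* C l), ∀ q, q ≠ 1 → 1 / 2 ≤ d l (ι q) 1 := by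
  have := Fintype.ofFinite Q
  let m : ℕ+ := ⟨Fintype.card Q, Fintype.card_pos⟩
  obtain ⟨W, -, hW⟩ := h.wreath 1 m Q (mul_one _).symm
  refine ⟨_, W.comp (inr.comp (MulAction.toPermHom Q Q)), fun q hq => hW _ fun a ha => hq ?_⟩
  exact mul_eq_right.1 ha

theorem isWreathClosed (h : IsSizeWreathClosed d) :
    MetricFamily.IsWreathClosed ⟨ℕ+, C, inferInstance, d⟩ where
  le_two := h.le_two
  self_eq_zero := h.self_eq_zero
  wreath n A _ _ := by
    obtain ⟨W, hW, -⟩ := h.wreath n (⟨Fintype.card A, Fintype.card_pos⟩ * n) A rfl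
    exact ⟨_, W, hW⟩
  prod := h.exists_prod_monoidHom
  finite := h.exists_monoidHom_of_finite

end IsSizeWreathClosed

end SizeIndexed

section Isometric

variable {A G H : Type*} [Fintype A] [Group G] [Group H] {dG : G → G → ℝ} {dH : H → H → ℝ}

theorem IsWreathEmbedding.of_isometry {W : PermWreath A G →* H}
    (hW : ∀ x y, dH (W x) (W y) = wreathDist dG x y) : IsWreathEmbedding dG dH W where
  dist_le x y := (hW x y).le
  le_dist f := by rw [← map_one W, hW]

theorem wreathDist_inr_one [Nonempty A] (d : G → G → ℝ) {σ : Equiv.Perm A} (hσ : ∀ a, σ a ≠ a) :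
    wreathDist d (inr σ : PermWreath A G) 1 = 1 := by
  have hcolumn (a : A) : columnDist d (inr σ : PermWreath A G) 1 a = 1 := columnDist_of_ne d (hσ a)
  simp only [wreathDist, hcolumn, Finset.sum_const, nsmul_eq_mul, mul_one, Finset.card_univ]
  exact div_self (Nat.cast_ne_zero.2 Fintype.card_ne_zero)

end Isometric

theorem IsSizeWreathClosed.of_isometry {C : ℕ+ → Type v} [∀ n, Group (C n)]
    {d : ∀ n, C n → C n → ℝ} (nonneg : ∀ n x y, 0 ≤ d n x y) (le_two : ∀ n x y, d n x y ≤ 2)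
    (self_eq_zero : ∀ n x, d n x x = 0)
    (wreath : ∀ (n m : ℕ+) (A : Type) [Fintype A], (m : ℕ) = Fintype.card A * n →
      ∃ W : PermWreath A (C n) →* C m, ∀ x y, d m (W x) (W y) = wreathDist (d n) x y) :
    IsSizeWreathClosed d where
  nonneg := nonneg
  le_two := le_two
  self_eq_zero := self_eq_zero
  wreath n m A _ hm := by
    obtain ⟨W, hW⟩ := wreath n m A hm
    have : Nonempty A := Fintype.card_pos_iff.1 (Nat.pos_of_mul_pos_right (hm ▸ m.pos))
    refine ⟨W, .of_isometry hW, fun σ hσ => ?_⟩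
    rw [← map_one W, hW, wreathDist_inr_one _ hσ]
    exact one_half_lt_one.le

/-! ## Symmetric groups -/

section Sym

variable {A B : Type*} [Fintype A] [Fintype B]

theorem permDist_eq_sum [DecidableEq A] (σ τ : Equiv.Perm A) :
    permDist σ τ = (∑ a, if σ a = τ a then (0 : ℝ) else 1) / Fintype.card A := by
  rw [permDist_eq_card_filter_div, ← Finset.sum_boole]
  simp only [ne_eq, ite_not]

theorem permDist_nonneg (σ τ : Equiv.Perm A) : 0 ≤ permDist σ τ := by
  unfold permDist; positivity

theorem permDist_le_one (σ τ : Equiv.Perm A) : permDist σ τ ≤ 1 := by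
  classical
  rw [permDist_eq_card_filter_div]
  exact div_le_one_of_le₀ (mod_cast Finset.card_le_univ _) (Nat.cast_nonneg _)

theorem permDist_self (σ : Equiv.Perm A) : permDist σ σ = 0 := by
  simp [permDist]

theorem permDist_permCongr (e : A ≃ B) (σ τ : Equiv.Perm A) :
    permDist (e.permCongr σ) (e.permCongr τ) = permDist σ τ := by
  classical
  rw [permDist_eq_sum, permDist_eq_sum, ← e.sum_comp, Fintype.card_congr e]
  simp only [Equiv.permCongr_apply, Equiv.symm_apply_apply, e.apply_eq_iff_eq]

end Sym

namespace PermWreath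

variable {A B : Type*}

/-- The imprimitive action of the wreath product `Sym(B) ≀ Sym(A)` on `A × B`. -/
def prodPerm : PermWreath A (Equiv.Perm B) →* Equiv.Perm (A × B) where
  toFun x := Equiv.prodShear x.right x.block
  map_one' := rfl
  map_mul' x y := Equiv.ext fun p => Prod.ext rfl (by simp [Equiv.prodShear, block_mul])

theorem permDist_prodPerm [Fintype A] [Fintype B] [Nonempty B]
    (x y : PermWreath A (Equiv.Perm B)) :
    permDist (prodPerm x) (prodPerm y) = wreathDist permDist x y := by
  classical
  rw [permDist_eq_sum, Fintype.sum_prod_type, Fintype.card_prod, Nat.cast_mul,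
    mul_comm (Fintype.card A : ℝ), ← div_div, Finset.sum_div, wreathDist]
  congr 1
  refine Finset.sum_congr rfl fun a _ => ?_
  by_cases h : x.right a = y.right a
  · rw [columnDist_of_eq _ h, permDist_eq_sum]
    simp [prodPerm, Equiv.prodShear, h]
  · rw [columnDist_of_ne _ h]
    simp [prodPerm, Equiv.prodShear, h]

end PermWreath

theorem symFamily_isWreathClosed : symFamily.IsWreathClosed := by
  refine IsSizeWreathClosed.isWreathClosed (C := fun n => Equiv.Perm (Fin n)) <|
    .of_isometry (fun _ => permDist_nonneg)
      (fun _ x y => (permDist_le_one x y).trans one_le_two) (fun _ => permDist_self)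
      fun n m A _ hm => ?_
  let e : A × Fin n ≃ Fin m := Fintype.equivOfCardEq (by simp [hm])
  have : Nonempty (Fin n) := ⟨⟨0, n.pos⟩⟩
  refine ⟨e.permCongrHom.toMonoidHom.comp prodPerm, fun x y => ?_⟩
  exact (permDist_permCongr e _ _).trans (permDist_prodPerm x y)

/-! ## Block monomial matrices -/

section BlockMonomial

variable {A ι R G : Type*} [Fintype A] [DecidableEq A] [Fintype ι] [DecidableEq ι] [Semiring R]
  [Group G]

/-- The representation of `G ≀ Sym(A)` by block monomial matrices induced from a matrix
representation `ρ` of `G`. -/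
def blockMonomial (ρ : G →* Matrix ι ι R) : PermWreath A G →* Matrix (A × ι) (A × ι) R where
  toFun x := Matrix.of fun p q => if p.1 = x.right q.1 then ρ (x.block q.1) p.2 q.2 else 0
  map_one' := by
    ext p q
    simp only [Matrix.of_apply, SemidirectProduct.one_right, Equiv.Perm.one_apply, block_one,
      map_one, Matrix.one_apply, Prod.ext_iff]
    split_ifs <;> simp_all
  map_mul' x y := by
    ext p q
    rw [Matrix.mul_apply, Fintype.sum_prod_type, Finset.sum_eq_single (y.right q.1)]
    · simp only [Matrix.of_apply, if_true, block_mul, map_mul, Matrix.mul_apply,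
        SemidirectProduct.mul_right, Equiv.Perm.mul_apply]
      split_ifs <;> simp only [zero_mul, Finset.sum_const_zero]
    · intro b _ hb
      simp only [Matrix.of_apply, if_neg hb, mul_zero, Finset.sum_const_zero]
    · simp

theorem blockMonomial_apply (ρ : G →* Matrix ι ι R) (x : PermWreath A G) (p q : A × ι) :
    blockMonomial ρ x p q = if p.1 = x.right q.1 then ρ (x.block q.1) p.2 q.2 else 0 := rfl

theorem star_blockMonomial [StarRing R] {ρ : G →* Matrix ι ι R} (hρ : ∀ g, star (ρ g) = ρ g⁻¹)
    (x : PermWreath A G) : star (blockMonomial ρ x) = blockMonomial ρ x⁻¹ := by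
  ext p q
  rw [Matrix.star_apply, blockMonomial_apply, blockMonomial_apply]
  have hright : p.1 = x⁻¹.right q.1 ↔ q.1 = x.right p.1 := by
    rw [SemidirectProduct.inv_right, Equiv.Perm.eq_inv_iff_eq, eq_comm]
  by_cases h : q.1 = x.right p.1
  · have hblock : x⁻¹.block q.1 = (x.block p.1)⁻¹ := by
      rw [eq_inv_iff_mul_eq_one, h, ← block_mul, inv_mul_cancel, block_one]
    rw [if_pos h, if_pos (hright.2 h), hblock, ← hρ, Matrix.star_apply]
  · rw [if_neg h, if_neg (mt hright.1 h), star_zero]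

end BlockMonomial

/-! ## Unitary groups -/

section Unitary

variable {A ι κ : Type*} [Fintype A] [Fintype ι] [Fintype κ]

/-- The square of the unnormalized Hilbert-Schmidt distance, summed by columns. -/
noncomputable def hsSq (M N : Matrix ι ι ℂ) : ℝ :=
  ∑ j, ∑ i, ‖M i j - N i j‖ ^ 2

theorem hsSq_reindex (e : ι ≃ κ) (M N : Matrix ι ι ℂ) :
    hsSq (Matrix.reindex e e M) (Matrix.reindex e e N) = hsSq M N := by
  unfold hsSq
  rw [← e.sum_comp]
  refine Finset.sum_congr rfl fun j _ => ?_
  rw [← e.sum_comp]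
  simp

variable [DecidableEq A] [DecidableEq ι] [DecidableEq κ]

/-- Half the square of the normalized Hilbert-Schmidt metric. With this normalization block
monomial matrices represent wreath products isometrically. -/
noncomputable def halfSqDist (M N : Matrix.unitaryGroup ι ℂ) : ℝ :=
  hsSq (M : Matrix ι ι ℂ) N / (2 * Fintype.card ι)

theorem hsDist_sq {n : ℕ} (M N : Matrix.unitaryGroup (Fin n) ℂ) :
    hsDist M N ^ 2 = 2 * halfSqDist M N := by
  rw [hsDist, Real.sq_sqrt (by positivity), Finset.sum_comm, halfSqDist, Fintype.card_fin,
    ← mul_div_assoc, mul_div_mul_left _ _ two_ne_zero]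
  rfl

theorem halfSqDist_nonneg (M N : Matrix.unitaryGroup ι ℂ) : 0 ≤ halfSqDist M N := by
  unfold halfSqDist hsSq; positivity

theorem halfSqDist_self (M : Matrix.unitaryGroup ι ℂ) : halfSqDist M M = 0 := by
  simp [halfSqDist, hsSq]

theorem sum_norm_sq_of_mem_unitaryGroup {M : Matrix ι ι ℂ} (hM : M ∈ Matrix.unitaryGroup ι ℂ)
    (j : ι) : ∑ i, ‖M i j‖ ^ 2 = 1 := by
  have h := congrFun (congrFun (Matrix.mem_unitaryGroup_iff'.1 hM) j) j
  simp only [Matrix.mul_apply, Matrix.one_apply_eq, Matrix.star_apply, Complex.star_def,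
    Complex.conj_mul'] at h
  exact_mod_cast h

theorem hsSq_le_of_mem_unitaryGroup {M N : Matrix ι ι ℂ} (hM : M ∈ Matrix.unitaryGroup ι ℂ)
    (hN : N ∈ Matrix.unitaryGroup ι ℂ) : hsSq M N ≤ 4 * Fintype.card ι := by
  have hentry (i j : ι) : ‖M i j - N i j‖ ^ 2 ≤ 2 * ‖M i j‖ ^ 2 + 2 * ‖N i j‖ ^ 2 := by
    nlinarith [norm_sub_le (M i j) (N i j), norm_nonneg (M i j - N i j),
      sq_nonneg (‖M i j‖ - ‖N i j‖)]
  calc hsSq M N ≤ ∑ j, ∑ i, (2 * ‖M i j‖ ^ 2 + 2 * ‖N i j‖ ^ 2) :=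
        Finset.sum_le_sum fun j _ => Finset.sum_le_sum fun i _ => hentry i j
    _ = ∑ _j : ι, (4 : ℝ) := Finset.sum_congr rfl fun j _ => by
        rw [Finset.sum_add_distrib, ← Finset.mul_sum, ← Finset.mul_sum,
          sum_norm_sq_of_mem_unitaryGroup hM, sum_norm_sq_of_mem_unitaryGroup hN]
        norm_num
    _ = 4 * Fintype.card ι := by rw [Finset.sum_const, nsmul_eq_mul, Finset.card_univ, mul_comm]

theorem halfSqDist_le_two (M N : Matrix.unitaryGroup ι ℂ) : halfSqDist M N ≤ 2 :=
  div_le_of_le_mul₀ (by positivity) two_pos.le <|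
    (hsSq_le_of_mem_unitaryGroup M.2 N.2).trans_eq (by ring)

theorem blockMonomial_mem_unitaryGroup (x : PermWreath A (Matrix.unitaryGroup ι ℂ)) :
    blockMonomial (Matrix.unitaryGroup ι ℂ).subtype x ∈ Matrix.unitaryGroup (A × ι) ℂ := by
  rw [Matrix.mem_unitaryGroup_iff', star_blockMonomial (fun _ => rfl), ← map_mul, inv_mul_cancel,
    map_one]

theorem reindex_mem_unitaryGroup (e : ι ≃ κ) {M : Matrix ι ι ℂ}
    (hM : M ∈ Matrix.unitaryGroup ι ℂ) : Matrix.reindex e e M ∈ Matrix.unitaryGroup κ ℂ := by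
  rw [Matrix.mem_unitaryGroup_iff'] at hM ⊢
  rw [Matrix.star_eq_conjTranspose, Matrix.conjTranspose_reindex, Matrix.reindex_apply,
    Matrix.reindex_apply, Matrix.submatrix_mul_equiv, ← Matrix.star_eq_conjTranspose, hM,
    Matrix.submatrix_one_equiv]

/-- The monomial representation of `U(ι) ≀ Sym(A)` on `ℂ^(A × ι)`, in the coordinates given
by `e`. -/
noncomputable def blockUnitary (e : A × ι ≃ κ) :
    PermWreath A (Matrix.unitaryGroup ι ℂ) →* Matrix.unitaryGroup κ ℂ :=
  ((Matrix.reindexAlgEquiv ℂ ℂ e).toMonoidHom.comp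
    (blockMonomial (Matrix.unitaryGroup ι ℂ).subtype)).codRestrict _
      fun x => reindex_mem_unitaryGroup e (blockMonomial_mem_unitaryGroup x)

theorem sum_blockMonomial_sub_of_eq {x y : PermWreath A (Matrix.unitaryGroup ι ℂ)} {a : A}
    (h : x.right a = y.right a) :
    ∑ j, ∑ p, ‖blockMonomial (Matrix.unitaryGroup ι ℂ).subtype x p (a, j) -
      blockMonomial (Matrix.unitaryGroup ι ℂ).subtype y p (a, j)‖ ^ 2 =
      hsSq (x.block a : Matrix ι ι ℂ) (y.block a) := by
  refine Finset.sum_congr rfl fun j _ => ?_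
  rw [Fintype.sum_prod_type, Finset.sum_eq_single (x.right a)]
  · simp [blockMonomial_apply, h]
  · intro b _ hb
    simp [blockMonomial_apply, hb, h ▸ hb]
  · simp

/- Columns with blocks in different rows have disjoint supports, so they are orthogonal unit
vectors. -/
theorem sum_blockMonomial_sub_of_ne {x y : PermWreath A (Matrix.unitaryGroup ι ℂ)} {a : A}
    (h : x.right a ≠ y.right a) :
    ∑ j, ∑ p, ‖blockMonomial (Matrix.unitaryGroup ι ℂ).subtype x p (a, j) -
      blockMonomial (Matrix.unitaryGroup ι ℂ).subtype y p (a, j)‖ ^ 2 = 2 * Fintype.card ι := by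
  have hentry (p : A × ι) (j : ι) :
      ‖blockMonomial (Matrix.unitaryGroup ι ℂ).subtype x p (a, j) -
        blockMonomial (Matrix.unitaryGroup ι ℂ).subtype y p (a, j)‖ ^ 2 =
      ‖blockMonomial (Matrix.unitaryGroup ι ℂ).subtype x p (a, j)‖ ^ 2 +
        ‖blockMonomial (Matrix.unitaryGroup ι ℂ).subtype y p (a, j)‖ ^ 2 := by
    by_cases hp : p.1 = x.right a
    · simp [blockMonomial_apply, hp, h]
    · simp [blockMonomial_apply, hp]
  simp only [hentry, Finset.sum_add_distrib,
    sum_norm_sq_of_mem_unitaryGroup (blockMonomial_mem_unitaryGroup _), Finset.sum_const,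
    Finset.card_univ, nsmul_eq_mul, mul_one]
  ring

theorem hsSq_blockMonomial [Nonempty ι] (x y : PermWreath A (Matrix.unitaryGroup ι ℂ)) :
    hsSq (blockMonomial (Matrix.unitaryGroup ι ℂ).subtype x)
      (blockMonomial (Matrix.unitaryGroup ι ℂ).subtype y) =
      2 * Fintype.card ι * ∑ a, columnDist halfSqDist x y a := by
  have hcard : (2 * Fintype.card ι : ℝ) ≠ 0 := by simp
  rw [hsSq, Fintype.sum_prod_type, Finset.mul_sum]
  refine Finset.sum_congr rfl fun a _ => ?_
  by_cases h : x.right a = y.right a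
  · rw [columnDist_of_eq _ h, sum_blockMonomial_sub_of_eq h, halfSqDist, mul_div_cancel₀ _ hcard]
  · rw [columnDist_of_ne _ h, sum_blockMonomial_sub_of_ne h, mul_one]

theorem halfSqDist_blockUnitary [Nonempty ι] (e : A × ι ≃ κ)
    (x y : PermWreath A (Matrix.unitaryGroup ι ℂ)) :
    halfSqDist (blockUnitary e x) (blockUnitary e y) = wreathDist halfSqDist x y := by
  have hι : (2 * Fintype.card ι : ℝ) ≠ 0 := by simp
  have hκ : (2 * Fintype.card κ : ℝ) = 2 * Fintype.card ι * Fintype.card A := by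
    rw [← Fintype.card_congr e, Fintype.card_prod]
    push_cast
    ring
  have hreindex : hsSq (blockUnitary e x : Matrix κ κ ℂ) (blockUnitary e y) =
      hsSq (blockMonomial (Matrix.unitaryGroup ι ℂ).subtype x)
        (blockMonomial (Matrix.unitaryGroup ι ℂ).subtype y) := hsSq_reindex e _ _
  rw [halfSqDist, hreindex, hsSq_blockMonomial, hκ, mul_div_mul_left _ _ hι, wreathDist]

end Unitary

theorem isWreathClosed_halfSqDist :
    MetricFamily.IsWreathClosed
      ⟨ℕ+, fun n => Matrix.unitaryGroup (Fin n) ℂ, inferInstance, fun _ => halfSqDist⟩ := by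
  classical
  refine IsSizeWreathClosed.isWreathClosed (C := fun n => Matrix.unitaryGroup (Fin n) ℂ) <|
    .of_isometry (fun _ => halfSqDist_nonneg) (fun _ => halfSqDist_le_two)
      (fun _ => halfSqDist_self) fun n m A _ hm => ?_
  have : Nonempty (Fin n) := ⟨⟨0, n.pos⟩⟩
  exact ⟨blockUnitary (Fintype.equivOfCardEq (by simp [hm])), halfSqDist_blockUnitary _⟩

theorem isApproximable_halfSqDist_iff {Λ : Type w} [Group Λ] :
    IsApproximable
      ⟨ℕ+, fun n => Matrix.unitaryGroup (Fin n) ℂ, inferInstance, fun _ => halfSqDist⟩ Λ ↔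
      IsApproximable unitaryFamily Λ := by
  have hdist {n : ℕ} (M N : Matrix.unitaryGroup (Fin n) ℂ) :
      hsDist M N = Real.sqrt (2 * halfSqDist M N) := by
    rw [← hsDist_sq]
    exact (Real.sqrt_sq (Real.sqrt_nonneg _)).symm
  have hnonneg {n : ℕ} (M N : Matrix.unitaryGroup (Fin n) ℂ) : 0 ≤ 2 * halfSqDist M N :=
    mul_nonneg two_pos.le (halfSqDist_nonneg M N)
  constructor
  · refine IsApproximable.of_dist_comparison
      (fun c hc => ⟨Real.sqrt (2 * c), by positivity, fun n M h => ?_⟩)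
      fun ε hε => ⟨ε ^ 2 / 2, by positivity, fun n M N h => ?_⟩
    · rw [hdist]
      exact Real.sqrt_lt_sqrt (by positivity) (by linarith)
    · rw [hdist, Real.sqrt_lt (hnonneg M N) hε.le]
      linarith
  · refine IsApproximable.of_dist_comparison
      (fun c hc => ⟨c ^ 2 / 2, by positivity, fun n M h => ?_⟩)
      fun ε hε => ⟨Real.sqrt (2 * ε), by positivity, fun n M N h => ?_⟩
    · rw [hdist, Real.lt_sqrt hc.le] at h
      linarith
    · rw [hdist, Real.sqrt_lt_sqrt_iff (hnonneg M N)] at h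
      linarith

/-! ## General linear groups -/

section Rank

theorem two_mul_card_quot_le {B : Type*} [Fintype B] {τ : Equiv.Perm B} (hτ : ∀ b, τ b ≠ b) :
    2 * Nat.card (Quot fun b c => τ b = c) ≤ Fintype.card B := by
  let pick : Bool × (Quot fun b c => τ b = c) → B := fun x => if x.1 then x.2.out else τ x.2.out
  have mk_pick (x) : Quot.mk _ (pick x) = x.2 := by
    obtain ⟨_ | _, q⟩ := x
    · exact (Quot.sound (r := fun b c => τ b = c) rfl).symm.trans (Quot.out_eq q)
    · exact Quot.out_eq q
  have hinj : Function.Injective pick := by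
    rintro ⟨b, q⟩ ⟨b', q'⟩ h
    obtain rfl : q = q' := (mk_pick (b, q)).symm.trans ((congrArg _ h).trans (mk_pick (b', q')))
    cases b <;> cases b'
    exacts [rfl, absurd h (hτ _), absurd h.symm (hτ _), rfl]
  have hcard := Nat.card_le_card_of_injective pick hinj
  rwa [Nat.card_prod, Nat.card_eq_fintype_card (α := Bool), Nat.card_eq_fintype_card (α := B),
    Fintype.card_bool] at hcard

variable {K : Type*} [Field K] {A ι p : Type*} [Fintype A] [Fintype ι]

theorem natCast_rank_eq (M : Matrix p ι K) :
    (M.rank : Cardinal) = LinearMap.rank M.mulVecLin :=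
  Module.finrank_eq_rank _ _

theorem rank_le_sum_rank_submatrix [Finite p] (M : Matrix p (A × ι) K) :
    M.rank ≤ ∑ a, (M.submatrix id (Prod.mk a)).rank := by
  have hsum : M.mulVecLin =
      ∑ a, (M.submatrix id (Prod.mk a)).mulVecLin ∘ₗ LinearMap.funLeft K K (Prod.mk a) := by
    ext1 v
    funext x
    simp [Matrix.mulVec, dotProduct, Fintype.sum_prod_type, LinearMap.funLeft_apply]
  rw [← Nat.cast_le (α := Cardinal), natCast_rank_eq, hsum, Nat.cast_sum]
  refine (LinearMap.rank_finsetSum_le _ _).trans (Finset.sum_le_sum fun a _ => ?_)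
  rw [natCast_rank_eq]
  exact LinearMap.rank_comp_le_left _ _

theorem exists_mul_mul_eq_diagonal [DecidableEq ι] (M : Matrix ι ι K) :
    ∃ (V U : Matrix ι ι K) (w : ι → K),
      V * M * U = Matrix.diagonal w ∧ (Matrix.diagonal w).rank = M.rank := by
  obtain ⟨V, U, e, hV, hU, h⟩ := M.exists_rank_normal_form
  have hdiag : V * M * U =
      Matrix.diagonal fun i => Sum.elim (fun _ => (1 : K)) (fun _ => 0) (e i) := by
    rw [h, ← Matrix.diagonal_one, ← Matrix.diagonal_zero, Matrix.fromBlocks_diagonal,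
      Matrix.submatrix_diagonal_equiv]
    rfl
  refine ⟨V, U, _, hdiag, ?_⟩
  rw [← hdiag, Matrix.rank_mul_eq_left_of_isUnit_det _ _ ((Matrix.isUnit_iff_isUnit_det _).1 hU),
    Matrix.rank_mul_eq_right_of_isUnit_det _ _ ((Matrix.isUnit_iff_isUnit_det _).1 hV)]

theorem sum_rank_le_rank_blockDiagonal [DecidableEq A] (M : A → Matrix ι ι K) :
    ∑ a, (M a).rank ≤ (Matrix.blockDiagonal M).rank := by
  classical
  choose V U w h hrank using fun a => exists_mul_mul_eq_diagonal (M a)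
  calc ∑ a, (M a).rank = ∑ a, (Matrix.diagonal (w a)).rank := by simp only [hrank]
    _ = (Matrix.diagonal fun p : ι × A => w p.2 p.1).rank := by
        simp only [Matrix.rank_diagonal, Fintype.card_subtype, Finset.card_filter,
          Fintype.sum_prod_type_right]
    _ = (Matrix.blockDiagonal V * Matrix.blockDiagonal M * Matrix.blockDiagonal U).rank := by
        rw [← Matrix.blockDiagonal_mul, ← Matrix.blockDiagonal_mul,
          ← Matrix.blockDiagonal_diagonal]
        simp only [h]
    _ ≤ (Matrix.blockDiagonal M).rank :=
        (Matrix.rank_mul_le_left _ _).trans (Matrix.rank_mul_le_right _ _)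

/- The vectors fixed by a permutation matrix are the functions constant on its cycles. -/
theorem card_le_two_mul_rank_permMatrix_sub_one {B : Type*} [Fintype B] [DecidableEq B]
    {τ : Equiv.Perm B} (hτ : ∀ b, τ b ≠ b) :
    Fintype.card B ≤ 2 * (τ.permMatrix K - 1).rank := by
  classical
  have := Fintype.ofFinite (Quot fun b c => τ b = c)
  have hker : LinearMap.ker (τ.permMatrix K - 1).mulVecLin ≤
      LinearMap.range (LinearMap.funLeft K K (Quot.mk fun b c => τ b = c)) := by
    intro v hv
    rw [LinearMap.mem_ker, Matrix.mulVecLin_apply, Matrix.sub_mulVec, Matrix.permMatrix_mulVec,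
      Matrix.one_mulVec, sub_eq_zero] at hv
    exact ⟨Quot.lift v fun b c hbc => hbc ▸ (congrFun hv b).symm, rfl⟩
  have hnullity := (Submodule.finrank_mono hker).trans (LinearMap.finrank_range_le _)
  have hrank := LinearMap.finrank_range_add_finrank_ker (τ.permMatrix K - 1).mulVecLin
  have hquot := two_mul_card_quot_le hτ
  rw [Module.finrank_fintype_fun_eq_card] at hnullity hrank
  rw [Nat.card_eq_fintype_card] at hquot
  change (τ.permMatrix K - 1).rank + _ = _ at hrank
  omega

variable [DecidableEq A] [DecidableEq ι]

theorem rank_blockMonomial_sub_le (x y : PermWreath A (GL ι K)) :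
    (blockMonomial (Units.coeHom _) x - blockMonomial (Units.coeHom _) y).rank ≤
      ∑ a, if x.right a = y.right a then (x.block a - y.block a : Matrix ι ι K).rank
        else Fintype.card ι := by
  refine (rank_le_sum_rank_submatrix _).trans (Finset.sum_le_sum fun a _ => ?_)
  split_ifs with h
  · have hfactor : (blockMonomial (Units.coeHom _) x -
        blockMonomial (Units.coeHom _) y).submatrix id (Prod.mk a) =
        (Matrix.of fun (p : A × ι) i => if p = (x.right a, i) then (1 : K) else 0) *
          (x.block a - y.block a : Matrix ι ι K) := by
      ext ⟨b, i⟩ j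
      by_cases hb : b = y.right a <;> simp [Matrix.mul_apply, blockMonomial_apply, h, hb]
    rw [hfactor]
    exact Matrix.rank_mul_le_right _ _
  · exact Matrix.rank_le_card_width _

theorem sum_rank_sub_one_le_rank_blockMonomial_sub_one (f : A → GL ι K) :
    ∑ a, (f a - 1 : Matrix ι ι K).rank ≤ (blockMonomial (Units.coeHom _) (inl f) - 1).rank := by
  have hblock : blockMonomial (Units.coeHom _) (inl f) - 1 =
      (Matrix.blockDiagonal fun a => (f a - 1 : Matrix ι ι K)).submatrix
        (Equiv.prodComm A ι) (Equiv.prodComm A ι) := by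
    ext ⟨a, i⟩ ⟨b, j⟩
    by_cases hab : a = b <;>
      simp [blockMonomial_apply, Matrix.blockDiagonal_apply, Matrix.one_apply, hab]
  rw [hblock, Matrix.rank_submatrix]
  exact sum_rank_le_rank_blockDiagonal _

theorem blockMonomial_inr (σ : Equiv.Perm A) :
    blockMonomial (Units.coeHom (Matrix ι ι K)) (inr σ) =
      Equiv.Perm.permMatrix K (Equiv.prodCongr σ (Equiv.refl ι))⁻¹ := by
  ext ⟨a, i⟩ ⟨b, j⟩
  by_cases hab : a = σ b <;>
    simp [blockMonomial_apply, PEquiv.toMatrix_apply, Matrix.one_apply, Equiv.symm_apply_eq, hab]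

variable {κ : Type*} [Fintype κ] [DecidableEq κ]

/-- The monomial representation of `GL(ι) ≀ Sym(A)` on `K^(A × ι)`, in the coordinates given
by `e`. -/
def blockGL (e : A × ι ≃ κ) : PermWreath A (GL ι K) →* GL κ K :=
  ((Matrix.reindexAlgEquiv K K e).toMonoidHom.comp (blockMonomial (Units.coeHom _))).toHomUnits

theorem rank_blockGL_sub (e : A × ι ≃ κ) (x y : PermWreath A (GL ι K)) :
    (blockGL e x - blockGL e y : Matrix κ κ K).rank =
      (blockMonomial (Units.coeHom _) x - blockMonomial (Units.coeHom _) y).rank :=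
  Matrix.rank_reindex e e (blockMonomial (Units.coeHom _) x - blockMonomial (Units.coeHom _) y)

theorem card_le_two_mul_rank_blockGL_inr_sub_one (e : A × ι ≃ κ) {σ : Equiv.Perm A}
    (hσ : ∀ a, σ a ≠ a) :
    Fintype.card κ ≤ 2 * (blockGL (K := K) e (inr σ) - (1 : GL κ K) : Matrix κ κ K).rank := by
  rw [← map_one (blockGL (K := K) e), rank_blockGL_sub,
    map_one (blockMonomial (Units.coeHom (Matrix ι ι K))), blockMonomial_inr,
    ← Fintype.card_congr e]
  refine card_le_two_mul_rank_permMatrix_sub_one fun p hp => ?_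
  exact hσ p.1 (congrArg Prod.fst (Equiv.Perm.inv_eq_iff_eq.1 hp).symm)

end Rank

section RankDist

variable {K : Type k} [Field K]

theorem rankDist_nonneg {n : ℕ} (M N : GL (Fin n) K) : 0 ≤ rankDist M N := by
  unfold rankDist; positivity

theorem rankDist_le_one {n : ℕ} (M N : GL (Fin n) K) : rankDist M N ≤ 1 :=
  div_le_one_of_le₀ (mod_cast (Matrix.rank_le_card_width _).trans_eq (Fintype.card_fin n))
    (Nat.cast_nonneg n)

theorem rankDist_self {n : ℕ} (M : GL (Fin n) K) : rankDist M M = 0 := by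
  simp [rankDist]

variable {A : Type*} [Fintype A] [DecidableEq A]

theorem isWreathEmbedding_blockGL {n m : ℕ} (hn : n ≠ 0) (e : A × Fin n ≃ Fin m) :
    IsWreathEmbedding (rankDist (K := K)) rankDist (blockGL e) := by
  have hn₀ : (n : ℝ) ≠ 0 := Nat.cast_ne_zero.2 hn
  have hm : (m : ℝ) = n * Fintype.card A := by
    simpa [mul_comm] using congrArg (Nat.cast (R := ℝ)) (Fintype.card_congr e).symm
  have wreathDist_eq (x y : PermWreath A (GL (Fin n) K)) : wreathDist rankDist x y =
      (∑ a, if x.right a = y.right a then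
        ((x.block a - y.block a : Matrix (Fin n) (Fin n) K).rank : ℝ) else n) / m := by
    rw [wreathDist, hm, ← div_div]
    congr 1
    rw [Finset.sum_div]
    refine Finset.sum_congr rfl fun a _ => ?_
    simp only [columnDist, rankDist]
    split_ifs <;> simp [hn₀]
  constructor
  · intro x y
    rw [wreathDist_eq, rankDist, rank_blockGL_sub]
    gcongr
    have hle := rank_blockMonomial_sub_le x y
    rw [Fintype.card_fin] at hle
    exact_mod_cast hle
  · intro f
    rw [← map_one (blockGL e), wreathDist_eq, rankDist, rank_blockGL_sub]
    gcongr
    simpa using (Nat.cast_le (α := ℝ)).2 (sum_rank_sub_one_le_rank_blockMonomial_sub_one f)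

end RankDist

theorem glFamily_isWreathClosed (K : Type k) [Field K] : (glFamily K).IsWreathClosed := by
  classical
  refine IsSizeWreathClosed.isWreathClosed (C := fun n => GL (Fin n) K)
    ⟨fun _ => rankDist_nonneg, fun _ M N => (rankDist_le_one M N).trans one_le_two,
      fun _ => rankDist_self, fun n m A _ hm => ?_⟩
  let e : A × Fin n ≃ Fin m := Fintype.equivOfCardEq (by simp [hm])
  refine ⟨blockGL e, isWreathEmbedding_blockGL n.ne_zero e, fun σ hσ => ?_⟩
  have hcard := card_le_two_mul_rank_blockGL_inr_sub_one (K := K) e hσ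
  rw [Fintype.card_fin, ← Nat.cast_le (α := ℝ)] at hcard
  rw [rankDist, div_le_div_iff₀ two_pos (Nat.cast_pos.2 m.pos)]
  rw [Nat.cast_mul, Nat.cast_two] at hcard
  linarith

/-! ## Finite groups with bi-invariant metrics -/

namespace FiniteMetricGroup

section Metric

variable (H : FiniteMetricGroup)

theorem self_eq_zero (x : H.carrier) : H.d x x = 0 := (H.eq_iff x x).2 rfl

theorem nonneg (x y : H.carrier) : 0 ≤ H.d x y := by
  have h := H.triangle x y x
  rw [H.self_eq_zero, H.symm y x] at h
  linarith

variable {A : Type*} (x y z : PermWreath A H.carrier) (a : A)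

theorem columnDist_nonneg : 0 ≤ columnDist H.d x y a := by
  rw [columnDist]
  split_ifs
  exacts [H.nonneg _ _, zero_le_one]

theorem columnDist_le_one : columnDist H.d x y a ≤ 1 :=
  columnDist_le le_rfl H.le_one x y a

theorem columnDist_comm : columnDist H.d x y a = columnDist H.d y x a := by
  by_cases h : x.right a = y.right a
  · rw [columnDist_of_eq _ h, columnDist_of_eq _ h.symm, H.symm]
  · rw [columnDist_of_ne _ h, columnDist_of_ne _ (Ne.symm h)]

theorem columnDist_triangle :
    columnDist H.d x z a ≤ columnDist H.d x y a + columnDist H.d y z a := by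
  by_cases hxy : x.right a = y.right a
  · by_cases hyz : y.right a = z.right a
    · rw [columnDist_of_eq _ hxy, columnDist_of_eq _ hyz, columnDist_of_eq _ (hxy.trans hyz)]
      exact H.triangle _ _ _
    · rw [columnDist_of_ne _ hyz]
      linarith [H.columnDist_le_one x z a, H.columnDist_nonneg x y a]
  · rw [columnDist_of_ne _ hxy]
    linarith [H.columnDist_le_one x z a, H.columnDist_nonneg y z a]

theorem columnDist_mul_left : columnDist H.d (z * x) (z * y) a = columnDist H.d x y a := by
  by_cases h : x.right a = y.right a
  · have hz : (z * x).right a = (z * y).right a := congrArg z.right h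
    rw [columnDist_of_eq _ h, columnDist_of_eq _ hz, block_mul, block_mul, h, H.mul_left]
  · have hz : (z * x).right a ≠ (z * y).right a := z.right.injective.ne h
    rw [columnDist_of_ne _ h, columnDist_of_ne _ hz]

theorem columnDist_mul_right :
    columnDist H.d (x * z) (y * z) a = columnDist H.d x y (z.right a) := by
  by_cases h : x.right (z.right a) = y.right (z.right a)
  · have hz : (x * z).right a = (y * z).right a := h
    rw [columnDist_of_eq _ h, columnDist_of_eq _ hz, block_mul, block_mul, H.mul_right]
  · have hz : (x * z).right a ≠ (y * z).right a := h
    rw [columnDist_of_ne _ h, columnDist_of_ne _ hz]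

theorem columnDist_eq_zero_iff :
    columnDist H.d x y a = 0 ↔ x.right a = y.right a ∧ x.block a = y.block a := by
  rw [columnDist]
  split_ifs with h <;> simp [h, H.eq_iff]

end Metric

/-- The wreath product of a finite metric group with a finite symmetric group. -/
noncomputable def wreath (H : FiniteMetricGroup) (A : Type) [Fintype A] [Nonempty A] :
    FiniteMetricGroup where
  carrier := PermWreath A H.carrier
  d := wreathDist H.d
  eq_iff x y := by
    rw [wreathDist, div_eq_zero_iff, or_iff_left (Nat.cast_ne_zero.2 Fintype.card_ne_zero),
      Finset.sum_eq_zero_iff_of_nonneg fun a _ => H.columnDist_nonneg x y a]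
    simp only [Finset.mem_univ, true_implies, columnDist_eq_zero_iff, forall_and]
    exact ⟨fun h => ext_block h.1 h.2, by rintro rfl; exact ⟨fun _ => rfl, fun _ => rfl⟩⟩
  symm x y := by simp only [wreathDist, H.columnDist_comm x y]
  triangle x y z := by
    rw [wreathDist, wreathDist, wreathDist, ← add_div, ← Finset.sum_add_distrib]
    gcongr
    exact H.columnDist_triangle x y z _
  mul_left z x y := by simp only [wreathDist, H.columnDist_mul_left]
  mul_right z x y := by
    simp only [wreathDist, H.columnDist_mul_right]
    rw [Equiv.sum_comp z.right (columnDist H.d x y)]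
  le_one x y := by
    refine div_le_one_of_le₀ ?_ (Nat.cast_nonneg _)
    exact (Finset.sum_le_card_nsmul _ _ 1 fun a _ => H.columnDist_le_one x y a).trans_eq (by simp)
  exists_eq_one := by
    obtain ⟨x, y, h⟩ := H.exists_eq_one
    exact ⟨inl fun _ => x, inl fun _ => y, (wreathDist_inl_const H.d x y).trans h⟩

/-- The product of two finite metric groups, with the maximum metric. -/
noncomputable def prod (H H' : FiniteMetricGroup) : FiniteMetricGroup where
  carrier := H.carrier × H'.carrier
  d x y := max (H.d x.1 y.1) (H'.d x.2 y.2)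
  eq_iff x y := by
    rw [Prod.ext_iff, ← H.eq_iff, ← H'.eq_iff]
    refine ⟨fun h => ?_, fun ⟨h, h'⟩ => by rw [h, h', max_self]⟩
    exact ⟨((le_max_left _ _).trans_eq h).antisymm (H.nonneg _ _),
      ((le_max_right _ _).trans_eq h).antisymm (H'.nonneg _ _)⟩
  symm x y := by rw [H.symm, H'.symm]
  triangle x y z := max_le
    ((H.triangle _ _ _).trans (add_le_add (le_max_left _ _) (le_max_left _ _)))
    ((H'.triangle _ _ _).trans (add_le_add (le_max_right _ _) (le_max_right _ _)))
  mul_left z x y := by simp [H.mul_left, H'.mul_left]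
  mul_right z x y := by simp [H.mul_right, H'.mul_right]
  le_one x y := max_le (H.le_one _ _) (H'.le_one _ _)
  exists_eq_one := by
    obtain ⟨x, y, h⟩ := H.exists_eq_one
    exact ⟨(x, 1), (y, 1), by simp [h, H'.self_eq_zero]⟩

open Classical in
/-- A nontrivial finite group with the discrete metric. -/
noncomputable def discrete (G : Type) [Group G] [Finite G] [Nontrivial G] : FiniteMetricGroup where
  carrier := G
  d x y := if x = y then 0 else 1
  eq_iff x y := by simp
  symm x y := by simp only [eq_comm]
  triangle x y z := by
    by_cases hxy : x = y
    · simp [hxy]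
    · rw [if_neg hxy]
      split_ifs <;> norm_num
  mul_left z x y := by simp only [mul_right_inj]
  mul_right z x y := by simp only [mul_left_inj]
  le_one x y := by split_ifs <;> norm_num
  exists_eq_one := by
    obtain ⟨x, y, h⟩ := exists_pair_ne G
    exact ⟨x, y, if_neg h⟩

end FiniteMetricGroup

theorem finiteFamily_isWreathClosed : finiteFamily.IsWreathClosed where
  le_two H x y := (FiniteMetricGroup.le_one H x y).trans one_le_two
  self_eq_zero H := FiniteMetricGroup.self_eq_zero H
  wreath H A _ _ :=
    ⟨FiniteMetricGroup.wreath H A, MonoidHom.id (FiniteMetricGroup.wreath H A).carrier,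
      .of_isometry (H := (FiniteMetricGroup.wreath H A).carrier) fun _ _ => rfl⟩
  prod H H' := by
    refine ⟨FiniteMetricGroup.prod H H', MonoidHom.id (FiniteMetricGroup.prod H H').carrier,
      fun x y => ?_, fun x => ⟨?_, ?_⟩⟩
    · exact max_le_add_of_nonneg (FiniteMetricGroup.nonneg H _ _) (FiniteMetricGroup.nonneg H' _ _)
    · exact (half_le_self (FiniteMetricGroup.nonneg H _ _)).trans (le_max_left _ _)
    · exact (half_le_self (FiniteMetricGroup.nonneg H' _ _)).trans (le_max_right _ _)
  finite Q _ _ := by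
    refine ⟨FiniteMetricGroup.discrete (Q × Equiv.Perm Bool),
      MonoidHom.inl Q (Equiv.Perm Bool), fun q hq => ?_⟩
    exact one_half_lt_one.le.trans_eq (if_neg fun h => hq (congrArg Prod.fst h)).symm

/-! ## The four classes -/

theorem GroupClass.Mem.semidirectProduct {𝒞 : GroupClass.{k}} {N Γ : Type*} [Group N] [Group Γ]
    (hN : 𝒞.Mem N) (hΓ : 𝒞.Mem Γ) {act : Γ →* MulAut N} (hact : IsSoficAutAction act) :
    𝒞.Mem (N ⋊[act] Γ) := by
  cases 𝒞 with
  | sofic => exact IsApproximable.semidirectProduct symFamily_isWreathClosed act hN hΓ hact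
  | linearSofic K =>
    exact IsApproximable.semidirectProduct (glFamily_isWreathClosed K) act hN hΓ hact
  | hyperlinear =>
    exact isApproximable_halfSqDist_iff.1 <| IsApproximable.semidirectProduct
      isWreathClosed_halfSqDist act (isApproximable_halfSqDist_iff.2 hN)
      (isApproximable_halfSqDist_iff.2 hΓ) hact
  | weaklySofic =>
    exact IsApproximable.semidirectProduct finiteFamily_isWreathClosed act hN hΓ hact

theorem IsLEF.mem {Λ : Type w} [Group Λ] (h : IsLEF Λ) (𝒞 : GroupClass.{k}) : 𝒞.Mem Λ := by
  cases 𝒞 with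
  | sofic => exact h.isApproximable symFamily_isWreathClosed
  | linearSofic K => exact h.isApproximable (glFamily_isWreathClosed K)
  | hyperlinear =>
    exact isApproximable_halfSqDist_iff.1 (h.isApproximable isWreathClosed_halfSqDist)
  | weaklySofic => exact h.isApproximable finiteFamily_isWreathClosed

/-! ## Residually finite groups -/

theorem residuallyFinite_of_injective {K K' : Type*} [Group K] [Group K']
    [Group.ResiduallyFinite K'] (f : K →* K') (hf : Function.Injective f) :
    Group.ResiduallyFinite K := by
  rw [Group.residuallyFinite_iff_forall_finiteIndexNormalSubgroup]
  intro x hx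
  refine (map_eq_one_iff f hf).1 ?_
  exact Group.eq_one_iff_forall_finiteIndexNormalSubroup _ fun H => hx (H.comap f)

theorem finite_monoidHom_of_fg (K Q : Type*) [Group K] [Monoid Q] [Group.FG K] [Finite Q] :
    Finite (K →* Q) := by
  obtain ⟨S, hS, hSfin⟩ := Group.fg_iff.1 (inferInstance : Group.FG K)
  have := hSfin.to_subtype
  refine Finite.of_injective (fun (f : K →* Q) (x : S) => f x) fun f g h => ?_
  exact MonoidHom.eq_of_eqOn_dense hS fun x hx => congrFun h ⟨x, hx⟩

/-- The permutation action of `Aut(K)` on the homomorphisms from `K` to `Q`, by precomposition with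
the inverse. For finitely generated `K` and finite `Q` it acts on a finite set. -/
def mulAutToPermMonoidHom (K Q : Type*) [Group K] [Monoid Q] : MulAut K →* Equiv.Perm (K →* Q) where
  toFun := MulEquiv.monoidHomCongrLeftEquiv
  map_one' := rfl
  map_mul' _ _ := rfl

/-- Baumslag's theorem. -/
theorem residuallyFinite_mulAut (K : Type*) [Group K] [Group.FG K] [Group.ResiduallyFinite K] :
    Group.ResiduallyFinite (MulAut K) := by
  refine Group.residuallyFinite_of_forall_exists_finite_monoidHom fun β hβ => ?_
  obtain ⟨x, hx⟩ : ∃ x, β x ≠ x := by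
    by_contra! h
    exact hβ (MulEquiv.ext h)
  obtain ⟨H, hH⟩ := Group.exists_finiteIndexNormalSubgroup_of_residuallyFinite _ _ hx
  have := finite_monoidHom_of_fg K (K ⧸ H.toSubgroup)
  refine ⟨_, _, inferInstance, mulAutToPermMonoidHom K (K ⧸ H.toSubgroup), fun h => hH ?_⟩
  have hmk : (QuotientGroup.mk' H.toSubgroup).comp (β.symm : K →* K) = QuotientGroup.mk' _ :=
    DFunLike.congr_fun h (QuotientGroup.mk' H.toSubgroup)
  simpa using (DFunLike.congr_fun hmk (β x)).symm

theorem exists_finiteIndexNormalSubgroup_forall_notMem {K : Type*} [Group K]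
    [Group.ResiduallyFinite K] (F : Finset K) :
    ∃ H : FiniteIndexNormalSubgroup K, ∀ x ∈ F, x ≠ 1 → x ∉ H := by
  classical
  induction F using Finset.induction_on with
  | empty => exact ⟨.ofSubgroup ⊤, by simp⟩
  | insert x F _ ih =>
    obtain ⟨H, hH⟩ := ih
    by_cases hx : x = 1
    · exact ⟨H, (Finset.forall_mem_insert _ _ _).2 ⟨fun hx1 => absurd hx hx1, hH⟩⟩
    · obtain ⟨H', hH'⟩ := Group.exists_finiteIndexNormalSubgroup_notMem x hx
      refine ⟨H ⊓ H', (Finset.forall_mem_insert _ _ _).2 ⟨fun _ h => hH' ?_, fun y hy hy1 h => ?_⟩⟩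
      · exact (inf_le_right : H ⊓ H' ≤ H') h
      · exact hH y hy hy1 ((inf_le_left : H ⊓ H' ≤ H) h)

theorem IsLEF.of_forall_finset_subset_residuallyFinite {Λ : Type*} [Group Λ]
    (h : ∀ F : Finset Λ, ∃ K : Subgroup Λ, (F : Set Λ) ⊆ K ∧ Group.ResiduallyFinite K) :
    IsLEF Λ := by
  classical
  intro F
  obtain ⟨K, hFK, _⟩ := h F
  obtain ⟨H, hH⟩ := exists_finiteIndexNormalSubgroup_forall_notMem (F.subtype (· ∈ K))
  obtain ⟨Q, _, _, ⟨e⟩⟩ := Finite.exists_type_univ_nonempty_mulEquiv.{_, 0} (K ⧸ H.toSubgroup)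
  let q : K →* Q := (e : K ⧸ H.toSubgroup →* Q).comp (QuotientGroup.mk' H.toSubgroup)
  let φ : Λ → Q := fun x => if hx : x ∈ K then q ⟨x, hx⟩ else 1
  have hφ {x : Λ} (hx : x ∈ K) : φ x = q ⟨x, hx⟩ := dif_pos hx
  refine ⟨Q, ‹_›, inferInstance, φ, ?_, fun x hx y hy _ => ?_, fun x hx hx1 => ?_⟩
  · rw [hφ K.one_mem]
    exact map_one q
  · rw [hφ (hFK hx), hφ (hFK hy), hφ (K.mul_mem (hFK hx) (hFK hy)), ← map_mul]
    rfl
  · have hxH : (⟨x, hFK hx⟩ : K) ∉ H :=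
      hH _ (Finset.mem_subtype.2 hx) fun h => hx1 (congrArg Subtype.val h)
    rw [hφ (hFK hx)]
    simpa [q, FiniteIndexNormalSubgroup.mem_toSubgroup_iff] using hxH

/-- The restriction of automorphisms to a subgroup which they preserve. -/
def restrictMulAut {G : Type*} [Group G] (H : Subgroup G) :
    MulAction.stabilizer (MulAut G) H →* MulAut H where
  toFun β := (Subgroup.equivSMul (β : MulAut G) H).trans (MulEquiv.subgroupCongr β.2)
  map_one' := rfl
  map_mul' _ _ := rfl

/-! ## Haloes of groups -/

section Halo

variable {X : Type u} {G : Type v} [Group G] {L : Set X → Subgroup G}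

theorem IsHalo.le_iSup_singleton_of_finite (hL : IsHalo L) (ha : HaloCondA L) {Y : Set X}
    (hY : Y.Finite) : L Y ≤ ⨆ y ∈ Y, L {y} := by
  induction Y, hY using Set.Finite.induction_on with
  | empty => exact hL.empty.trans_le bot_le
  | @insert z Z _ _ ih =>
    rw [Set.insert_eq, ha, iSup_union, iSup_singleton]
    exact sup_le_sup_left ih _

theorem IsHalo.eq_iSup_singleton (hL : IsHalo L) (ha : HaloCondA L) (Y : Set X) :
    L Y = ⨆ y ∈ Y, L {y} := by
  refine le_antisymm (fun x hx => ?_)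
    (iSup₂_le fun y hy => hL.mono _ _ (Set.singleton_subset_iff.2 hy))
  have hdir : Directed (· ≤ ·) fun Z : {Z : Set X // Z.Finite} => L Z := fun Z Z' =>
    ⟨⟨Z ∪ Z', Z.2.union Z'.2⟩, hL.mono _ _ Set.subset_union_left,
      hL.mono _ _ Set.subset_union_right⟩
  have hx_iSup : x ∈ ⨆ Z : {Z : Set X // Z.Finite}, L Z := by
    rw [← hL.iSup_finite, hL.univ]
    exact Subgroup.mem_top x
  have : Nonempty {Z : Set X // Z.Finite} := ⟨⟨∅, Set.finite_empty⟩⟩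
  obtain ⟨Z, hZ⟩ := (Subgroup.mem_iSup_of_directed hdir).1 hx_iSup
  have hx_inter : x ∈ L (Y ∩ Z) := (hL.inter Y Z).ge ⟨hx, hZ⟩
  have hle : ⨆ z ∈ Y ∩ Z, L {z} ≤ ⨆ z ∈ Y, L {z} := biSup_mono fun _ h => h.1
  exact hle (hL.le_iSup_singleton_of_finite ha (Z.2.subset Set.inter_subset_right) hx_inter)

theorem IsHalo.hom_ext (hL : IsHalo L) (ha : HaloCondA L) {H : Type*} [Monoid H]
    {f g : G →* H} (Y : Set X) (h : ∀ x ∈ L Y, f x = g x) (h' : ∀ x ∈ L Yᶜ, f x = g x) : f = g := by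
  have htop : (⊤ : Subgroup G) ≤ f.eqLocus g := by
    rw [← hL.univ, ← Set.union_compl_self Y, ha]
    exact sup_le h h'
  ext x
  exact htop (Subgroup.mem_top x)

theorem IsHalo.mulAut_ext (hL : IsHalo L) (ha : HaloCondA L) {β γ : MulAut G}
    (Y : Set X) (h : ∀ x ∈ L Y, β x = γ x) (h' : ∀ x ∈ L Yᶜ, β x = γ x) : β = γ :=
  MulEquiv.toMonoidHom_injective (hL.hom_ext ha Y h h')

/-- The set `autSupportedOn L Y` of automorphisms supported on `Y`, as a subgroup of the
automorphism group. -/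
def supportedMulAut (L : Set X → Subgroup G) (Y : Set X) : Subgroup (MulAut G) :=
  MulAction.stabilizer (MulAut G) (L Y) ⊓ fixingSubgroup (MulAut G) (L Yᶜ : Set G)

theorem mem_supportedMulAut_iff {Y : Set X} {β : MulAut G} :
    β ∈ supportedMulAut L Y ↔ β ∈ autSupportedOn L Y :=
  and_congr_right' Subtype.forall

theorem residuallyFinite_supportedMulAut (hL : IsHalo L) (ha : HaloCondA L) (Y : Set X)
    [Group.FG (L Y)] [Group.ResiduallyFinite (L Y)] :
    Group.ResiduallyFinite (supportedMulAut L Y) := by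
  have := residuallyFinite_mulAut (L Y)
  refine residuallyFinite_of_injective
    ((restrictMulAut (L Y)).comp (Subgroup.inclusion inf_le_left)) fun β γ h => Subtype.ext ?_
  refine hL.mulAut_ext ha Y (fun x hx => ?_) fun x hx => ?_
  · exact congrArg Subtype.val (DFunLike.congr_fun h (⟨x, hx⟩ : L Y))
  · exact ((mem_supportedMulAut_iff.1 β.2).2 x hx).trans
      ((mem_supportedMulAut_iff.1 γ.2).2 x hx).symm

theorem isLEF_autFin (hL : IsHalo L) (ha : HaloCondA L)
    (hfg : ∀ Y : Set X, Y.Finite → Group.FG (L Y) ∧ Group.ResiduallyFinite (L Y)) :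
    IsLEF (autFin L hL ha) := by
  refine .of_forall_finset_subset_residuallyFinite fun F => ?_
  choose Y hYfin hY using fun β : autFin L hL ha => β.2
  have hZfin : (⋃ β ∈ F, Y β).Finite := F.finite_toSet.biUnion fun β _ => hYfin β
  obtain ⟨_, _⟩ := hfg _ hZfin
  have := residuallyFinite_supportedMulAut hL ha (⋃ β ∈ F, Y β)
  refine ⟨(supportedMulAut L (⋃ β ∈ F, Y β)).comap (autFin L hL ha).subtype, fun β hβ => ?_,
    residuallyFinite_of_injective ((autFin L hL ha).subtype.subgroupComap _) fun β γ h => ?_⟩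
  · exact mem_supportedMulAut_iff.2 <|
      autSupportedOn_mono hL ha (Set.subset_biUnion_of_mem (u := Y) hβ) (hY β)
  · have hβγ := congrArg Subtype.val h
    exact Subtype.ext (Subtype.ext hβγ)

variable {K : Type*} [Group K]

/-- The pairs `(α, σ)` of an automorphism `α` of `L(X)` and a permutation `σ` of `X` such that `α`
permutes the embedded copies `i x` of the group of a point according to `σ`. -/
def coveringGroup (i : X → K →* G) : Subgroup (MulAut G × Equiv.Perm X) where
  carrier := {c | ∀ x k, c.1 (i x k) = i (c.2 x) k}
  one_mem' _ _ := rfl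
  mul_mem' {c c'} hc hc' x k := (congrArg c.1 (hc' x k)).trans (hc (c'.2 x) k)
  inv_mem' {c} hc x k := by
    have h : c.1 (i (c.2⁻¹ x) k) = i x k :=
      (hc _ k).trans (congrArg (i · k) (c.2.apply_symm_apply x))
    exact c.1.symm_apply_eq.2 h.symm

namespace coveringGroup

variable {i : X → K →* G}

instance : MulAction (coveringGroup i) X :=
  .compHom X ((MonoidHom.snd (MulAut G) (Equiv.Perm X)).comp (coveringGroup i).subtype)

variable (i) in
/-- The action of the covering group on `L(X)`. -/
def toMulAut : coveringGroup i →* MulAut G :=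
  (MonoidHom.fst (MulAut G) (Equiv.Perm X)).comp (coveringGroup i).subtype

theorem toMulAut_apply (c : coveringGroup i) (x : X) (k : K) :
    toMulAut i c (i x k) = i (c • x) k := c.2 x k

variable (hL : IsHalo L) (ha : HaloCondA L) (hi : ∀ x, (i x).range = L {x})
include hL ha hi

theorem map_toMulAut (c : coveringGroup i) (Y : Set X) :
    (L Y).map (toMulAut i c).toMonoidHom = L (c • Y) := by
  have hpoint (x : X) : (L {x}).map (toMulAut i c).toMonoidHom = L {c • x} := by
    rw [← hi, ← hi, ← MonoidHom.range_comp]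
    exact congrArg _ (MonoidHom.ext (toMulAut_apply c x))
  rw [hL.eq_iSup_singleton ha Y, hL.eq_iSup_singleton ha (c • Y), ← Set.image_smul, iSup_image]
  simp only [Subgroup.map_iSup, hpoint]

theorem toMulAut_eq_self {c : coveringGroup i} {Y : Set X} (hc : ∀ y ∈ Y, c • y = y) {x : G}
    (hx : x ∈ L Y) : toMulAut i c x = x := by
  have hle : L Y ≤ (toMulAut i c).toMonoidHom.eqLocus (MonoidHom.id G) := by
    rw [hL.eq_iSup_singleton ha Y]
    refine iSup₂_le fun y hy => ?_
    rw [← hi]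
    rintro _ ⟨k, rfl⟩
    exact (toMulAut_apply c y k).trans (by rw [hc y hy]; rfl)
  exact hle hx

theorem commute_toMulAut {c : coveringGroup i} {Y : Set X} (hc : ∀ y ∈ Y, c • y = y)
    {β : MulAut G} (hβ : β ∈ autSupportedOn L Y) : Commute (toMulAut i c) β := by
  have hcY : c • Yᶜ = Yᶜ := by
    rw [Set.smul_set_compl, ← Set.image_smul, Set.image_congr hc, Set.image_id']
  refine hL.mulAut_ext ha Y (fun x hx => ?_) fun x hx => ?_
  · have hβx : β x ∈ L Y := hβ.1.le ⟨x, hx, rfl⟩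
    change toMulAut i c (β x) = β (toMulAut i c x)
    rw [toMulAut_eq_self hL ha hi hc hβx, toMulAut_eq_self hL ha hi hc hx]
  · have hcx : toMulAut i c x ∈ L Yᶜ :=
      ((map_toMulAut hL ha hi c Yᶜ).trans (congrArg L hcY)).le ⟨x, hx, rfl⟩
    change toMulAut i c (β x) = β (toMulAut i c x)
    rw [hβ.2 x hx, hβ.2 _ hcx]

/-- The action of the covering group on `AL_f(X)` by conjugation. -/
def toMulAutAutFin : coveringGroup i →* MulAut (autFin L hL ha) :=
  autFinAction L hL ha (toMulAut i) (map_toMulAut hL ha hi)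

theorem toMulAutAutFin_apply_congr {c c' : coveringGroup i} {β : autFin L hL ha} {Y : Set X}
    (hβ : (β : MulAut G) ∈ autSupportedOn L Y) (hc : ∀ y ∈ Y, c • y = c' • y) :
    toMulAutAutFin hL ha hi c β = toMulAutAutFin hL ha hi c' β := by
  have hfix : ∀ y ∈ Y, (c'⁻¹ * c) • y = y := fun y hy => by
    rw [mul_smul, hc y hy, inv_smul_smul]
  have hβ_fixed : toMulAutAutFin hL ha hi (c'⁻¹ * c) β = β :=
    Subtype.ext (commute_toMulAut hL ha hi hfix hβ).mul_inv_cancel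
  rw [← mul_inv_cancel_left c' c, map_mul, MulAut.mul_apply, hβ_fixed]

end coveringGroup

end Halo

/-! ## Sofic actions on the support of a halo -/

/-- A form of soficity of an action on `X` in which the maps `f s`, injective on the finite set `E`,
take values in `X` itself, so that they extend to permutations of `X`. -/
def IsSelfSoficAction (Γ : Type*) [Group Γ] (X : Type*) [MulAction Γ X] : Prop :=
  ∀ (F : Finset Γ) (E : Finset X) (ε : ℝ), 0 < ε →
    ∃ (A : Type) (_ : Fintype A) (φ : Γ → Equiv.Perm A) (S : Finset A) (f : A → X → X),
      φ 1 = 1 ∧ IsMultiplicativeOn permDist F ε φ ∧ (1 - ε) * Fintype.card A < S.card ∧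
      (∀ s, Set.InjOn (f s) E) ∧
      ∀ g ∈ F, ∀ s ∈ S, φ g s ∈ S → ∀ x ∈ E, g • x ∈ E → f (φ g s) (g • x) = f s x

section SelfSofic

variable {Γ : Type*} [Group Γ] {X : Type*} [MulAction Γ X]

/-- Every action on a finite set `X` is approximated by the left translations of `Sym(X)`. -/
theorem IsSelfSoficAction.of_finite [Finite X] : IsSelfSoficAction Γ X := by
  classical
  have := Fintype.ofFinite X
  intro F E ε hε
  let e : Equiv.Perm X ≃ Fin (Fintype.card (Equiv.Perm X)) := Fintype.equivFin _
  let φ : Γ →* Equiv.Perm (Fin (Fintype.card (Equiv.Perm X))) :=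
    (e.permCongrHom : Equiv.Perm (Equiv.Perm X) →* _).comp
      ((MulAction.toPermHom (Equiv.Perm X) (Equiv.Perm X)).comp (MulAction.toPermHom Γ X))
  have hφ (g s) : e.symm (φ g s) = MulAction.toPerm g * e.symm s := e.symm_apply_apply _
  refine ⟨_, inferInstance, φ, Finset.univ, fun s => ⇑(e.symm s)⁻¹, map_one φ,
    fun g _ h _ _ => ?_, ?_, fun s => (e.symm s)⁻¹.injective.injOn, fun g _ s _ _ x _ _ => ?_⟩
  · rw [map_mul]
    simpa [permDist] using hε
  · rw [Finset.card_univ]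
    exact mul_lt_of_lt_one_left (Nat.cast_pos.2 (Fintype.card_pos_iff.2 ⟨e 1⟩)) (by linarith)
  · change (e.symm (φ g s))⁻¹ (MulAction.toPerm g x) = (e.symm s)⁻¹ x
    rw [hφ, mul_inv_rev, Equiv.Perm.mul_apply]
    exact congrArg _ ((MulAction.toPerm g).symm_apply_apply x)

theorem IsSoficAction.isSelfSoficAction (h : IsSoficAction Γ X) : IsSelfSoficAction Γ X := by
  classical
  cases finite_or_infinite X
  · exact .of_finite
  intro F E ε hε
  obtain ⟨A, _, φ, hφ1, hφ, B, _, S, π, hS, hπ⟩ := h F E ε hε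
  let j : B ↪ X := (Finite.equivFin B).toEmbedding.trans
    (Fin.valEmbedding.trans (Infinite.natEmbedding X))
  let f : A → X → X := fun s x =>
    if h : s ∈ S ∧ x ∈ E then j (π ⟨s, h.1⟩ ⟨x, h.2⟩) else x
  have hf {s} (hs : s ∈ S) {x} (hx : x ∈ E) : f s x = j (π ⟨s, hs⟩ ⟨x, hx⟩) := dif_pos ⟨hs, hx⟩
  refine ⟨A, inferInstance, φ, S, f, hφ1, hφ, hS, fun s x hx y hy hxy => ?_,
    fun g hg s hs hgs x hx hgx => ?_⟩
  · by_cases hs : s ∈ S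
    · rw [hf hs hx, hf hs hy] at hxy
      exact congrArg Subtype.val ((π ⟨s, hs⟩).injective (j.injective hxy))
    · have hfs (z) : f s z = z := dif_neg fun h => hs h.1
      rwa [hfs, hfs] at hxy
  · rw [hf hgs hgx, hf hs hx, hπ g hg _ hgx (by rwa [inv_smul_smul]) s hs hgs]
    simp only [inv_smul_smul]

end SelfSofic

theorem exists_mem_eqOn_of_swap_mem {X : Type*} [DecidableEq X] {P : Subgroup (Equiv.Perm X)}
    (hP : ∀ x y, Equiv.swap x y ∈ P) (E : Finset X) {f : X → X} (hf : Set.InjOn f E) :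
    ∃ σ ∈ P, Set.EqOn σ f E := by
  induction E using Finset.induction_on with
  | empty => exact ⟨1, P.one_mem, by simp⟩
  | insert x E hx ih =>
    obtain ⟨σ, hσP, hσ⟩ := ih (hf.mono (by simp))
    refine ⟨Equiv.swap (σ x) (f x) * σ, P.mul_mem (hP _ _) hσP, fun y hy => ?_⟩
    rw [Equiv.Perm.mul_apply]
    rcases Finset.mem_insert.1 hy with rfl | hyE
    · exact Equiv.swap_apply_left _ _
    · have hyx : y ≠ x := ne_of_mem_of_not_mem hyE hx
      have hfyx : f y ≠ f x := fun h => hyx (hf hy (Finset.mem_insert_self x E) h)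
      rw [Equiv.swap_apply_of_ne_of_ne (σ.injective.ne hyx) (hσ hyE ▸ hfyx), hσ hyE]

theorem isSoficAutAction_autFinAction {X : Type u} {G : Type v} [Group G] [DecidableEq X]
    {L : Set X → Subgroup G} (hL : IsHalo L) (ha : HaloCondA L)
    {Γ : Type w} [Group Γ] [MulAction Γ X] (hΓ : IsSelfSoficAction Γ X) (a : Γ →* MulAut G)
    (haL : ∀ (g : Γ) (Y : Set X), (L Y).map (a g).toMonoidHom = L (g • Y))
    {K : Type*} [Group K] {i : X → K →* G} (hi : ∀ x, (i x).range = L {x})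
    (hai : ∀ g : Γ, (a g, MulAction.toPerm g) ∈ coveringGroup i)
    (hswap : ∀ x y, ∃ α, (α, Equiv.swap x y) ∈ coveringGroup i) :
    IsSoficAutAction (autFinAction L hL ha a haL) := by
  classical
  intro F P ε hε
  choose Y hYfin hY using fun β : autFin L hL ha => β.2
  let Z : Finset X := P.biUnion fun β => (hYfin β).toFinset
  have hZ {β} (hβ : β ∈ P) {x} (hx : x ∈ Y β) : x ∈ Z :=
    Finset.mem_biUnion.2 ⟨β, hβ, (hYfin β).mem_toFinset.2 hx⟩
  let E : Finset X := Z ∪ (F ×ˢ Z).image fun p => p.1 • p.2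
  obtain ⟨A, _, φ, S, f, hφ1, hφ, hS, hfinj, hf⟩ := hΓ F E ε hε
  have hext (s : A) : ∃ c : coveringGroup i, ∀ x ∈ E, c • x = f s x := by
    obtain ⟨_, ⟨c, hc, rfl⟩, hcE⟩ := exists_mem_eqOn_of_swap_mem
      (P := (coveringGroup i).map (MonoidHom.snd _ _))
      (fun x y => let ⟨α, hα⟩ := hswap x y; ⟨_, hα, rfl⟩) E (hfinj s)
    exact ⟨⟨c, hc⟩, hcE⟩
  choose c hc using hext
  let γ : Γ → coveringGroup i := fun g => ⟨(a g, MulAction.toPerm g), hai g⟩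
  let conj : coveringGroup i →* MulAut (autFin L hL ha) := coveringGroup.toMulAutAutFin hL ha hi
  refine ⟨A, inferInstance, φ, S, fun s => (conj (c s)).toMonoidHom, hφ1, hφ, hS,
    fun s => (conj (c s)).injective, fun g hg β hβ s hs hgs => ?_⟩
  have hagree : ∀ x ∈ Y β, (c (φ g s) * γ g) • x = c s • x := fun x hx => by
    have hxE : x ∈ E := Finset.mem_union_left _ (hZ hβ hx)
    have hgxE : g • x ∈ E := Finset.mem_union_right _ <|
      Finset.mem_image.2 ⟨(g, x), Finset.mk_mem_product hg (hZ hβ hx), rfl⟩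
    rw [mul_smul, hc s x hxE, ← hf g hg s hs hgs x hxE hgxE]
    exact hc _ _ hgxE
  have key : conj (c (φ g s) * γ g) β = conj (c s) β :=
    coveringGroup.toMulAutAutFin_apply_congr hL ha hi (hY β) hagree
  rwa [map_mul] at key

/-! ## Set-theoretic and graph-theoretic haloes -/

theorem fg_and_residuallyFinite_range {K G : Type*} [Group K] [Group G] {f : K →* G}
    (hf : Function.Injective f) (h : Group.FG K ∧ Group.ResiduallyFinite K) :
    Group.FG f.range ∧ Group.ResiduallyFinite f.range := by
  obtain ⟨_, _⟩ := h
  exact ⟨Group.fg_range f, residuallyFinite_of_injective (MonoidHom.ofInjective hf).symm.toMonoidHom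
    (MonoidHom.ofInjective hf).symm.injective⟩

namespace SetHalo

variable (𝓛 : SetHalo.{u, v}) {X : Type u}

theorem map_map {Z Y : Type u} (g : Y ↪ X) (f : Z ↪ Y) (k : 𝓛.obj Z) :
    𝓛.map g (𝓛.map f k) = 𝓛.map (f.trans g) k :=
  (DFunLike.congr_fun (𝓛.map_trans f g) k).symm

/-- The embedding `L({*}) → L(X)` of the group of a point whose image is `L({x})`. -/
def point (x : X) : 𝓛.obj PUnit.{u + 1} →* 𝓛.obj X :=
  𝓛.map ⟨fun _ => x, fun _ _ _ => rfl⟩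

theorem map_point {Y : Type u} (f : Y ↪ X) (y : Y) (k : 𝓛.obj PUnit.{u + 1}) :
    𝓛.map f (𝓛.point y k) = 𝓛.point (f y) k :=
  𝓛.map_map f _ k

theorem point_range (x : X) : (𝓛.point x).range = 𝓛.sub {x} := by
  refine le_antisymm ?_ ?_
  · rintro _ ⟨k, rfl⟩
    exact ⟨𝓛.point ⟨x, rfl⟩ k, 𝓛.map_point _ _ k⟩
  · rintro _ ⟨k, rfl⟩
    refine ⟨𝓛.map (Equiv.equivPUnit.{_, u + 1} ({x} : Set X)).toEmbedding k, ?_⟩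
    rw [point, map_map]
    congr 2
    ext ⟨y, rfl⟩
    rfl

theorem mapEquiv_mem_coveringGroup (σ : Equiv.Perm X) :
    (𝓛.mapEquiv σ, σ) ∈ coveringGroup 𝓛.point := fun x k =>
  𝓛.map_point σ.toEmbedding x k

variable {𝓛} {Γ : Type w} [Group Γ] [MulAction Γ X]

theorem mem_autEnrichment {𝒞 : GroupClass.{k}} (ha : 𝓛.CondA) (hΓ : 𝒞.Mem Γ)
    (hact : IsSoficAction Γ X) (hN : 𝒞.Mem (𝓛.AutFin ha X)) :
    𝒞.Mem (𝓛.AutEnrichment ha Γ X) := by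
  classical
  exact hN.semidirectProduct hΓ <|
    isSoficAutAction_autFinAction _ _ hact.isSelfSoficAction _ _ 𝓛.point_range
      (fun g => 𝓛.mapEquiv_mem_coveringGroup (MulAction.toPerm g))
      fun x y => ⟨_, 𝓛.mapEquiv_mem_coveringGroup (Equiv.swap x y)⟩

theorem mem_autFin (ha : 𝓛.CondA) (𝒞 : GroupClass.{k})
    (hfg : ∀ Y : Set X, Y.Finite → Group.FG (𝓛.obj Y) ∧ Group.ResiduallyFinite (𝓛.obj Y)) :
    𝒞.Mem (𝓛.AutFin ha X) :=
  (isLEF_autFin _ _ fun Y hY =>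
    fg_and_residuallyFinite_range (𝓛.map_injective _) (hfg Y hY)).mem 𝒞

end SetHalo

theorem IsSoficGraphAction.isSoficAction {Γ : Type*} [Group Γ] {V : Type*} [MulAction Γ V]
    {X : SimpleGraph V} (h : IsSoficGraphAction Γ X) : IsSoficAction Γ V := fun F E ε hε => by
  obtain ⟨A, _, φ, hφ1, hφ, W, hW, _, S, π, hS, hπ⟩ := h F E ε hε
  exact ⟨A, _, φ, hφ1, hφ, W, hW, S, fun s => (π s).toEmbedding, hS, hπ⟩

namespace GraphHalo

variable (𝓛 : GraphHalo.{u, v}) {V : Type u} (X : SimpleGraph V)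

theorem map_map {U W : Type u} {Z : SimpleGraph U} {Y : SimpleGraph W} {X : SimpleGraph V}
    (g : Y ↪g X) (f : Z ↪g Y) (k : 𝓛.obj Z) : 𝓛.map g (𝓛.map f k) = 𝓛.map (g.comp f) k :=
  (DFunLike.congr_fun (𝓛.map_comp g f) k).symm

/-- The inclusion of a vertex into a graph, as an embedding of the graph with one vertex. -/
def pointEmbedding (x : V) : (⊥ : SimpleGraph PUnit.{u + 1}) ↪g X where
  toFun _ := x
  inj' _ _ _ := rfl
  map_rel_iff' := by simp

/-- The embedding `L({*}) → L(X)` of the group of a point whose image is `L({x})`. -/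
def point (x : V) : 𝓛.obj (⊥ : SimpleGraph PUnit.{u + 1}) →* 𝓛.obj X :=
  𝓛.map (pointEmbedding X x)

theorem map_point {W : Type u} {Y : SimpleGraph W} {X : SimpleGraph V} (f : Y ↪g X) (y : W)
    (k : 𝓛.obj (⊥ : SimpleGraph PUnit.{u + 1})) :
    𝓛.map f (𝓛.point Y y k) = 𝓛.point X (f y) k :=
  𝓛.map_map f _ k

/-- A singleton is isomorphic to a point, as an induced subgraph. -/
def singletonEmbedding (x : V) :
    X.induce ({x} : Set V) ↪g (⊥ : SimpleGraph PUnit.{u + 1}) where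
  toFun _ := PUnit.unit
  inj' _ _ _ := Subsingleton.elim _ _
  map_rel_iff' := by
    rintro ⟨a, rfl⟩ ⟨b, rfl⟩
    simp

theorem point_range (x : V) : (𝓛.point X x).range = 𝓛.sub X {x} := by
  refine le_antisymm ?_ ?_
  · rintro _ ⟨k, rfl⟩
    exact ⟨𝓛.point (X.induce ({x} : Set V)) ⟨x, rfl⟩ k, 𝓛.map_point _ _ k⟩
  · rintro _ ⟨k, rfl⟩
    refine ⟨𝓛.map (singletonEmbedding X x) k, ?_⟩
    rw [point, map_map]
    congr 2
    ext ⟨y, rfl⟩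
    rfl

theorem action_mem_coveringGroup {Γ : Type w} [Group Γ] [MulAction Γ V] {X : SimpleGraph V}
    (hX : IsGraphAction Γ X) (g : Γ) :
    (𝓛.action hX g, MulAction.toPerm g) ∈ coveringGroup (𝓛.point X) := fun x k =>
  𝓛.map_point (actIso hX g).toEmbedding x k

variable {𝓛 X}

theorem exists_mulAut_extending_mapIso (hb : HaloCondB (𝓛.sub X)) {Y : Set V} (hY : Y.Finite)
    (f : X.induce Y ≃g X.induce Y) :
    ∃ α ∈ autSupportedOn (𝓛.sub X) Y, ∀ z,
      α (𝓛.map (SimpleGraph.Embedding.induce Y) z) =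
        𝓛.map (SimpleGraph.Embedding.induce Y) (𝓛.mapIso f z) := by
  let e : 𝓛.obj (X.induce Y) ≃* 𝓛.sub X Y := MonoidHom.ofInjective (𝓛.map_injective _)
  obtain ⟨α, hα, hαf⟩ := hb Y hY ((e.symm.trans (𝓛.mapIso f)).trans e)
  refine ⟨α, hα, fun z => (hαf (e z)).trans ?_⟩
  rw [MulEquiv.trans_apply, MulEquiv.trans_apply, MulEquiv.symm_apply_apply]
  rfl

theorem exists_mem_coveringGroup (hb : HaloCondB (𝓛.sub X)) {Y : Set V} (hY : Y.Finite)
    (f : X.induce Y ≃g X.induce Y) {σ : Equiv.Perm V} (hσY : ∀ y : Y, σ y = f y)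
    (hσ : ∀ x ∉ Y, σ x = x) : ∃ α, (α, σ) ∈ coveringGroup (𝓛.point X) := by
  obtain ⟨α, hα, hαf⟩ := exists_mulAut_extending_mapIso hb hY f
  let ι := SimpleGraph.Embedding.induce (G := X) Y
  refine ⟨α, fun x k => ?_⟩
  by_cases hx : x ∈ Y
  · calc α (𝓛.point X x k)
        = α (𝓛.map ι (𝓛.point _ ⟨x, hx⟩ k)) :=
          congrArg α (𝓛.map_point ι ⟨x, hx⟩ k).symm
      _ = 𝓛.map ι (𝓛.mapIso f (𝓛.point _ ⟨x, hx⟩ k)) := hαf _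
      _ = 𝓛.map ι (𝓛.point _ (f ⟨x, hx⟩) k) :=
          congrArg _ (𝓛.map_point f.toEmbedding _ k)
      _ = 𝓛.point X (f ⟨x, hx⟩) k := 𝓛.map_point ι _ k
      _ = 𝓛.point X (σ x) k := by rw [← hσY]
  · have hxY : {x} ⊆ Yᶜ := Set.singleton_subset_iff.2 hx
    refine (hα.2 _ ((𝓛.isHalo X).mono _ _ hxY ?_)).trans (by rw [hσ x hx])
    exact (𝓛.point_range X x).le ⟨k, rfl⟩

variable (X) in
/-- The automorphism exchanging the vertices of an induced subgraph with at most two vertices. It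
exists whether or not they are adjacent. -/
def swapIso [DecidableEq V] (x y : V) :
    X.induce ({x, y} : Set V) ≃g X.induce ({x, y} : Set V) where
  toEquiv := Equiv.swap ⟨x, by simp⟩ ⟨y, by simp⟩
  map_rel_iff' := by
    rintro ⟨a, rfl | rfl⟩ ⟨b, rfl | rfl⟩ <;> simp [SimpleGraph.adj_comm]

/-- Condition (b) makes transpositions of vertices act on `L(X)`, although they need not be
automorphisms of the graph `X`. -/
theorem exists_swap_mem_coveringGroup [DecidableEq V] (hb : HaloCondB (𝓛.sub X)) (x y : V) :
    ∃ α, (α, Equiv.swap x y) ∈ coveringGroup (𝓛.point X) := by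
  refine exists_mem_coveringGroup hb (Set.toFinite {x, y}) (swapIso X x y) ?_ fun z hz => ?_
  · rintro ⟨z, rfl | rfl⟩ <;> simp [swapIso]
  · rw [Set.mem_insert_iff, Set.mem_singleton_iff, not_or] at hz
    exact Equiv.swap_apply_of_ne_of_ne hz.1 hz.2

variable {Γ : Type w} [Group Γ] [MulAction Γ V]

theorem mem_autEnrichment {𝒞 : GroupClass.{k}} (ha : 𝓛.CondA) (hb : HaloCondB (𝓛.sub X))
    (hΓ : 𝒞.Mem Γ) (hX : IsGraphAction Γ X) (hact : IsSoficAction Γ V)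
    (hN : 𝒞.Mem (𝓛.AutFin ha X)) : 𝒞.Mem (𝓛.AutEnrichment ha hX) := by
  classical
  exact hN.semidirectProduct hΓ <|
    isSoficAutAction_autFinAction _ _ hact.isSelfSoficAction _ _ (𝓛.point_range X)
      (𝓛.action_mem_coveringGroup hX) (exists_swap_mem_coveringGroup hb)

theorem mem_autFin (ha : 𝓛.CondA) (𝒞 : GroupClass.{k})
    (hfg : ∀ Y : Set V, Y.Finite →
      Group.FG (𝓛.obj (X.induce Y)) ∧ Group.ResiduallyFinite (𝓛.obj (X.induce Y))) :
    𝒞.Mem (𝓛.AutFin ha X) :=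
  (isLEF_autFin _ _ fun Y hY =>
    fg_and_residuallyFinite_range (𝓛.map_injective _) (hfg Y hY)).mem 𝒞

end GraphHalo

theorem mainTheorem12_general (𝒞 : GroupClass.{k}) (Γ : Type w) [Group Γ] (hΓ : 𝒞.Mem Γ) :
    (∀ (X : Type u) [MulAction Γ X], IsSoficAction Γ X →
      ∀ (𝓛 : SetHalo.{u, v}) (ha : 𝓛.CondA),
        (𝒞.Mem (𝓛.AutFin ha X) → 𝒞.Mem (𝓛.AutEnrichment ha Γ X)) ∧
        ((∀ Y : Set X, Y.Finite →
            Group.FG (𝓛.obj Y) ∧ Group.ResiduallyFinite (𝓛.obj Y)) →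
          𝒞.Mem (𝓛.AutFin ha X) ∧ 𝒞.Mem (𝓛.AutEnrichment ha Γ X))) ∧
    (∀ (V : Type u) (X : SimpleGraph V) [MulAction Γ V] (hX : IsGraphAction Γ X),
      IsSoficAction Γ V →
      ∀ (𝓛 : GraphHalo.{u, v}) (ha : 𝓛.CondA), HaloCondB (𝓛.sub X) →
        (𝒞.Mem (𝓛.AutFin ha X) → 𝒞.Mem (𝓛.AutEnrichment ha hX)) ∧
        ((∀ Y : Set V, Y.Finite →
            Group.FG (𝓛.obj (X.induce Y)) ∧ Group.ResiduallyFinite (𝓛.obj (X.induce Y))) →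
          𝒞.Mem (𝓛.AutFin ha X) ∧ 𝒞.Mem (𝓛.AutEnrichment ha hX))) := by
  refine ⟨fun X _ hact 𝓛 ha => ?_, fun V X _ hX hact 𝓛 ha hb => ?_⟩
  · have enrichment := SetHalo.mem_autEnrichment ha hΓ hact
    exact ⟨enrichment, fun hfg =>
      ⟨SetHalo.mem_autFin ha 𝒞 hfg, enrichment (SetHalo.mem_autFin ha 𝒞 hfg)⟩⟩
  · have enrichment := GraphHalo.mem_autEnrichment ha hb hΓ hX hact
    exact ⟨enrichment, fun hfg =>
      ⟨GraphHalo.mem_autFin ha 𝒞 hfg, enrichment (GraphHalo.mem_autFin ha 𝒞 hfg)⟩⟩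

theorem mainTheorem12 (𝒞 : GroupClass.{k}) (Γ : Type w) [Group Γ] (hΓ : 𝒞.Mem Γ) :
    (∀ (X : Type u) [MulAction Γ X], IsSoficAction Γ X →
      ∀ (𝓛 : SetHalo.{u, v}) (ha : 𝓛.CondA), 𝓛.CondB →
        (𝒞.Mem (𝓛.AutFin ha X) → 𝒞.Mem (𝓛.AutEnrichment ha Γ X)) ∧
        ((∀ Y : Set X, Y.Finite →
            Group.FG (𝓛.obj Y) ∧ Group.ResiduallyFinite (𝓛.obj Y)) →
          𝒞.Mem (𝓛.AutFin ha X) ∧ 𝒞.Mem (𝓛.AutEnrichment ha Γ X))) ∧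
    (∀ (V : Type u) (X : SimpleGraph V) [MulAction Γ V] (hX : IsGraphAction Γ X),
      IsSoficGraphAction Γ X →
      ∀ (𝓛 : GraphHalo.{u, v}) (ha : 𝓛.CondA), 𝓛.CondB →
        (𝒞.Mem (𝓛.AutFin ha X) → 𝒞.Mem (𝓛.AutEnrichment ha hX)) ∧
        ((∀ Y : Set V, Y.Finite →
            Group.FG (𝓛.obj (X.induce Y)) ∧ Group.ResiduallyFinite (𝓛.obj (X.induce Y))) →
          𝒞.Mem (𝓛.AutFin ha X) ∧ 𝒞.Mem (𝓛.AutEnrichment ha hX))) :=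
  ⟨fun X _ hact 𝓛 ha _ => (mainTheorem12_general 𝒞 Γ hΓ).1 X hact 𝓛 ha,
    fun V X _ hX hact 𝓛 ha hb =>
      (mainTheorem12_general 𝒞 Γ hΓ).2 V X hX hact.isSoficAction 𝓛 ha (hb V X)⟩
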